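/- For $T>0$ and an integrable real even function $f$ on $\mathbb{R}$, let $\widehat f(t)=\int_{\mathbb{R}}e^{i\lambda t}f(\lambda)\,d\lambda$ and let $W_T(f)$ be the $T$-truncated Toeplitz operator on $L^2[0,T]$, $$[W_T(f)u](t)=\int_0^T\widehat f(t-s)\,u(s)\,ds,\qquad u\in L^2[0,T].$$ **Theorem 4.4.** Let $\nu\ge 1$ be an integer and let $$f_i(\lambda)=\frac{C_i}{|\lambda|^{2\alpha_i}(1+\lambda^2)^{\beta_i}},\qquad C_i>0,\quad 0<\alpha_i<\tfrac12,\quad \alpha_i+\beta_i>\tfrac12,\qquad i=1,2,$$ be the spectral densities of two fractional Riesz–Bessel motions, and suppose that $\alpha_1+\alpha_2<1/(2\nu)$. Then $f_1$, $f_2$ and $(f_1f_2)^\nu$ are integrable on $\mathbb{R}$, the operator $[W_T(f_1)W_T(f_2)]^\nu$ is trace class for every $T>0$, and the approximation error $$\Delta_{\nu,W}(T):=\left|\frac1T\operatorname{tr}\bigl[W_T(f_1)W_T(f_2)\bigr]^\nu-(2\pi)^{2\nu-1}\int_{\mathbb{R}}[f_1(\lambda)f_2(\lambda)]^\nu\,d\lambda\right|$$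 satisfies, for every $\varepsilon>0$, $$\Delta_{\nu,W}(T)=O\left(T^{-\gamma+\varepsilon}\right)\quad\text{as } T\to\infty,\qquad\text{with}\quad \gamma=\frac1{2\nu}-(\alpha_1+\alpha_2).$$ -/

import Mathlib

open MeasureTheory Filter

noncomputable section

namespace TruncToeplitz

/-! Traces of trace class operators on a complex Hilbert space. -/

section Trace

variable {H : Type*} [NormedAddCommGroup H] [InnerProductSpace ℂ H]

/-- A bounded operator `A` on a Hilbert space is trace class (nuclear) if it is a sum of rank one
operators, `A u = ∑ ⟪x n, u⟫ • y n`, with `∑ ‖x n‖ * ‖y n‖ < ∞`. -/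
def IsTraceClass (A : H →L[ℂ] H) : Prop :=
  ∃ x y : ℕ → H, Summable (fun n => ‖x n‖ * ‖y n‖) ∧
    ∀ u : H, HasSum (fun n => inner ℂ (x n) u • y n) (A u)

/-- The trace `∑ ⟪b i, A (b i)⟫` of an operator with respect to an orthonormal basis `b`. For a
trace class operator the sum converges absolutely and does not depend on the basis, see
`IsTraceClass.hasSum_trace`. -/
def trace [CompleteSpace H] (A : H →L[ℂ] H) : ℂ :=
  ∑' i, inner ℂ ((exists_hilbertBasis ℂ H).choose_spec.choose i)
    (A ((exists_hilbertBasis ℂ H).choose_spec.choose i))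

theorem summable_and_tsum_le {ι : Type*} (b : HilbertBasis ι ℂ H) (x y : H) :
    Summable (fun i => ‖(inner ℂ x (b i) : ℂ)‖ * ‖(inner ℂ (b i) y : ℂ)‖) ∧
      ∑' i, ‖(inner ℂ x (b i) : ℂ)‖ * ‖(inner ℂ (b i) y : ℂ)‖ ≤ ‖x‖ * ‖y‖ := by
  have hb := b.orthonormal
  have hx : ∀ i, ‖(inner ℂ x (b i) : ℂ)‖ = ‖(inner ℂ (b i) x : ℂ)‖ := fun i => norm_inner_symm _ _
  simp only [hx]
  have hs : ∀ z : H, Summable fun i => ‖(inner ℂ (b i) z : ℂ)‖ ^ (2 : ℝ) := fun z => by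
    simpa using hb.inner_products_summable z
  have hle : ∀ z : H, (∑' i, ‖(inner ℂ (b i) z : ℂ)‖ ^ (2 : ℝ)) ^ (1 / (2 : ℝ)) ≤ ‖z‖ := fun z => by
    rw [← Real.sqrt_eq_rpow]
    refine Real.sqrt_le_iff.2 ⟨norm_nonneg _, ?_⟩
    simpa using hb.tsum_inner_products_le z
  obtain ⟨h1, h2⟩ := Real.summable_and_inner_le_Lp_mul_Lq_tsum_of_nonneg
    Real.HolderConjugate.two_two (fun i => norm_nonneg (inner ℂ (b i) x : ℂ))
    (fun i => norm_nonneg (inner ℂ (b i) y : ℂ)) (hs x) (hs y)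
  refine ⟨h1, h2.trans (mul_le_mul (hle x) (hle y) (by positivity) (norm_nonneg _))⟩

theorem hasSum_of_rep {ι : Type*} (b : HilbertBasis ι ℂ H) (A : H →L[ℂ] H)
    (x y : ℕ → H) (hxy : Summable (fun n => ‖x n‖ * ‖y n‖))
    (hA : ∀ u : H, HasSum (fun n => inner ℂ (x n) u • y n) (A u)) :
    HasSum (fun i => (inner ℂ (b i) (A (b i)) : ℂ)) (∑' n, (inner ℂ (x n) (y n) : ℂ)) := by
  let F : ℕ × ι → ℂ := fun p => inner ℂ (x p.1) (b p.2) * inner ℂ (b p.2) (y p.1)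
  have hF : Summable F := by
    refine Summable.of_norm ?_
    rw [summable_prod_of_nonneg (fun _ => norm_nonneg _)]
    simp only [F, norm_mul]
    refine ⟨fun n => (summable_and_tsum_le b (x n) (y n)).1, ?_⟩
    exact Summable.of_nonneg_of_le (fun n => tsum_nonneg fun i => by positivity)
      (fun n => (summable_and_tsum_le b (x n) (y n)).2) hxy
  have h1 : ∀ n, HasSum (fun i => F (n, i)) (inner ℂ (x n) (y n)) := fun n =>
    b.hasSum_inner_mul_inner (x n) (y n)
  have h2 : ∀ i, HasSum (fun n => F (n, i)) (inner ℂ (b i) (A (b i))) := fun i => by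
    have := (innerSL ℂ (b i)).hasSum (hA (b i))
    simpa [F, inner_smul_right, Function.comp_def] using this
  have h3 := hF.hasSum.prod_fiberwise h1
  have h4 := ((Equiv.prodComm ι ℕ).hasSum_iff.2 hF.hasSum).prod_fiberwise (fun i => h2 i)
  rwa [← h3.tsum_eq] at h4

/-- The trace of a trace class operator may be computed in every orthonormal basis. -/
theorem IsTraceClass.hasSum_trace [CompleteSpace H] {A : H →L[ℂ] H} (hA : IsTraceClass A)
    {ι : Type*} (b : HilbertBasis ι ℂ H) :
    HasSum (fun i => (inner ℂ (b i) (A (b i)) : ℂ)) (trace A) := by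
  obtain ⟨x, y, hxy, h⟩ := hA
  rw [trace, (hasSum_of_rep (exists_hilbertBasis ℂ H).choose_spec.choose A x y hxy h).tsum_eq]
  exact hasSum_of_rep b A x y hxy h

end Trace

/-! Truncated Toeplitz operators. -/

/-- The Fourier transform `t ↦ ∫ exp(i λ t) f(λ) dλ`. -/
def fourier (f : ℝ → ℝ) (t : ℝ) : ℂ :=
  ∫ l : ℝ, Complex.exp (Complex.I * (l : ℂ) * (t : ℂ)) * (f l : ℂ)

/-- The complex Hilbert space `L²[0,T]`. -/
abbrev L2 (T : ℝ) : Type := Lp ℂ 2 (volume.restrict (Set.Icc (0 : ℝ) T))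

theorem norm_exp_mul (f : ℝ → ℝ) (t l : ℝ) :
    ‖Complex.exp (Complex.I * (l : ℂ) * (t : ℂ)) * (f l : ℂ)‖ = |f l| := by
  rw [norm_mul, Complex.norm_exp]
  simp

theorem norm_fourier_le (f : ℝ → ℝ) (t : ℝ) : ‖fourier f t‖ ≤ ∫ l, |f l| := by
  refine (norm_integral_le_integral_norm _).trans (le_of_eq ?_)
  simp only [norm_exp_mul]

theorem continuous_fourier (f : ℝ → ℝ) : Continuous (fourier f) := by
  by_cases hf : Integrable f
  · refine continuous_of_dominated (bound := fun l => |f l|) (fun t => ?_)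
      (fun t => .of_forall fun l => (norm_exp_mul f t l).le) hf.abs
      (.of_forall fun l => by fun_prop)
    exact (Continuous.aestronglyMeasurable (by fun_prop)).mul
      (Complex.continuous_ofReal.comp_aestronglyMeasurable hf.1)
  · have : fourier f = fun _ => 0 := by
      funext t
      refine integral_undef fun h => hf ?_
      have h1 : Integrable (fun l : ℝ => Complex.exp (-(Complex.I * (l : ℂ) * (t : ℂ))) *
          (Complex.exp (Complex.I * (l : ℂ) * (t : ℂ)) * (f l : ℂ))) :=
        h.bdd_mul (c := 1) (Continuous.aestronglyMeasurable (by fun_prop))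
          (.of_forall fun l => by rw [Complex.norm_exp]; simp)
      have h2 := h1.re
      refine h2.congr (.of_forall fun l => ?_)
      simp [← mul_assoc, ← Complex.exp_add]
    rw [this]
    exact continuous_const

/-- The function `t ↦ ∫₀ᵀ f̂(t - s) u(s) ds`. -/
def toeplitzFun (T : ℝ) (f : ℝ → ℝ) (u : L2 T) (t : ℝ) : ℂ :=
  ∫ s in Set.Icc (0 : ℝ) T, fourier f (t - s) * u s

theorem integrable_L2 {T : ℝ} (u : L2 T) : Integrable u (volume.restrict (Set.Icc (0 : ℝ) T)) :=
  (Lp.memLp u).integrable (by norm_num)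

theorem integrable_kernel {T : ℝ} (f : ℝ → ℝ) (u : L2 T) (t : ℝ) :
    Integrable (fun s => fourier f (t - s) * u s) (volume.restrict (Set.Icc (0 : ℝ) T)) :=
  (integrable_L2 u).bdd_mul
    (((continuous_fourier f).comp (by fun_prop : Continuous fun s => t - s)).aestronglyMeasurable)
    (.of_forall fun s => norm_fourier_le f (t - s))

theorem continuous_toeplitzFun (T : ℝ) (f : ℝ → ℝ) (u : L2 T) :
    Continuous (toeplitzFun T f u) := by
  refine continuous_of_dominated (bound := fun s => (∫ l, |f l|) * ‖u s‖)
    (fun t => (integrable_kernel f u t).1) (fun t => .of_forall fun s => ?_)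
    ((integrable_L2 u).norm.const_mul _) (.of_forall fun s => ?_)
  · rw [norm_mul]
    exact mul_le_mul_of_nonneg_right (norm_fourier_le f _) (norm_nonneg _)
  · exact ((continuous_fourier f).comp (by fun_prop : Continuous fun t => t - s)).mul
      continuous_const

theorem exists_bound (T : ℝ) : ∃ c : ℝ, 0 ≤ c ∧ ∀ u : L2 T,
    ∫ s in Set.Icc (0 : ℝ) T, ‖u s‖ ≤ c * ‖u‖ := by
  refine ⟨((volume.restrict (Set.Icc (0 : ℝ) T)) Set.univ ^
    (1 / (1 : ENNReal).toReal - 1 / (2 : ENNReal).toReal)).toReal, ENNReal.toReal_nonneg,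
    fun u => ?_⟩
  have h := eLpNorm_le_eLpNorm_mul_rpow_measure_univ (p := 1) (q := 2)
    (μ := volume.restrict (Set.Icc (0 : ℝ) T)) (by norm_num) (Lp.aestronglyMeasurable u)
  rw [integral_norm_eq_lintegral_enorm (Lp.aestronglyMeasurable u),
    ← eLpNorm_one_eq_lintegral_enorm, Lp.norm_def, mul_comm, ← ENNReal.toReal_mul]
  refine ENNReal.toReal_mono (ENNReal.mul_ne_top (Lp.eLpNorm_ne_top u) ?_) h
  exact ENNReal.rpow_ne_top_of_nonneg (by norm_num) (measure_ne_top _ _)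

theorem norm_toeplitzFun_le (T : ℝ) (f : ℝ → ℝ) (u : L2 T) (t : ℝ) :
    ‖toeplitzFun T f u t‖ ≤ (∫ l, |f l|) * ∫ s in Set.Icc (0 : ℝ) T, ‖u s‖ := by
  rw [← integral_const_mul]
  refine norm_integral_le_of_norm_le ((integrable_L2 u).norm.const_mul _) (.of_forall fun s => ?_)
  rw [norm_mul]
  exact mul_le_mul_of_nonneg_right (norm_fourier_le f _) (norm_nonneg _)

theorem memLp_toeplitzFun (T : ℝ) (f : ℝ → ℝ) (u : L2 T) :
    MemLp (toeplitzFun T f u) 2 (volume.restrict (Set.Icc (0 : ℝ) T)) :=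
  MemLp.of_bound (continuous_toeplitzFun T f u).aestronglyMeasurable _
    (.of_forall fun t => norm_toeplitzFun_le T f u t)

theorem toeplitzFun_add (T : ℝ) (f : ℝ → ℝ) (u v : L2 T) (t : ℝ) :
    toeplitzFun T f (u + v) t = toeplitzFun T f u t + toeplitzFun T f v t := by
  unfold toeplitzFun
  rw [← integral_add (integrable_kernel f u t) (integrable_kernel f v t)]
  refine integral_congr_ae ?_
  filter_upwards [Lp.coeFn_add u v] with s hs
  rw [hs, Pi.add_apply, mul_add]

theorem toeplitzFun_smul (T : ℝ) (f : ℝ → ℝ) (c : ℂ) (u : L2 T) (t : ℝ) :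
    toeplitzFun T f (c • u) t = c * toeplitzFun T f u t := by
  unfold toeplitzFun
  rw [← integral_const_mul]
  refine integral_congr_ae ?_
  filter_upwards [Lp.coeFn_smul c u] with s hs
  rw [hs, Pi.smul_apply, smul_eq_mul]
  ring

/-- The `T`-truncated Toeplitz operator generated by `f`, that is the integral operator
`u ↦ ∫₀ᵀ f̂(· - s) u(s) ds` on `L²[0,T]`, as a bounded operator. -/
def W (T : ℝ) (f : ℝ → ℝ) : L2 T →L[ℂ] L2 T :=
  LinearMap.mkContinuousOfExistsBound
    { toFun := fun u => (memLp_toeplitzFun T f u).toLp (toeplitzFun T f u)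
      map_add' := fun u v => by
        rw [← MemLp.toLp_add]
        exact MemLp.toLp_congr _ _ (.of_forall fun t => toeplitzFun_add T f u v t)
      map_smul' := fun c u => by
        rw [RingHom.id_apply, ← MemLp.toLp_const_smul]
        exact MemLp.toLp_congr _ _ (.of_forall fun t => toeplitzFun_smul T f c u t) }
    (by
      obtain ⟨c, hc, h⟩ := exists_bound T
      have hM : 0 ≤ ∫ l, |f l| := integral_nonneg fun l => abs_nonneg _
      refine ⟨(measureUnivNNReal (volume.restrict (Set.Icc (0 : ℝ) T)) : ℝ) ^
        (2 : ENNReal).toReal⁻¹ * ((∫ l, |f l|) * c), fun u => ?_⟩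
      rw [mul_assoc]
      refine Lp.norm_le_of_ae_bound (by positivity) ?_
      filter_upwards [(memLp_toeplitzFun T f u).coeFn_toLp] with t ht
      simp only [LinearMap.coe_mk, AddHom.coe_mk]
      rw [ht, mul_assoc]
      exact (norm_toeplitzFun_le T f u t).trans (mul_le_mul_of_nonneg_left (h u) hM))

theorem W_apply (T : ℝ) (f : ℝ → ℝ) (u : L2 T) :
    W T f u =ᵐ[volume.restrict (Set.Icc (0 : ℝ) T)]
      fun t => ∫ s in Set.Icc (0 : ℝ) T, fourier f (t - s) * u s :=
  (memLp_toeplitzFun T f u).coeFn_toLp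

/-- The normalized trace `(1/T) tr [W_T(f₁) W_T(f₂)]^ν`. -/
def S (ν : ℕ) (f₁ f₂ : ℝ → ℝ) (T : ℝ) : ℂ :=
  (1 / (T : ℂ)) * trace ((W T f₁ * W T f₂) ^ ν)

/-- The approximation error
`|(1/T) tr [W_T(f₁) W_T(f₂)]^ν - (2π)^(2ν-1) ∫ (f₁(λ) f₂(λ))^ν dλ|` (for `ν ≥ 1`). -/
def Δ (ν : ℕ) (f₁ f₂ : ℝ → ℝ) (T : ℝ) : ℝ :=
  ‖S ν f₁ f₂ T - (((2 * Real.pi) ^ (2 * ν - 1) * ∫ l : ℝ, (f₁ l * f₂ l) ^ ν : ℝ) : ℂ)‖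

/-- The spectral density `C |λ|^(-2α) (1 + λ²)^(-β)` of a fractional Riesz-Bessel motion. -/
def rieszBessel (C α β : ℝ) (l : ℝ) : ℝ :=
  C / (|l| ^ (2 * α) * (1 + l ^ 2) ^ β)

end TruncToeplitz

end

/-! Weakly, `W T f` is the integral of the rank one operators f(l)|e_l⟩⟨e_l|, with e_l(t) = exp(ilt)
on [0,T]. Two exponentials pair to a Dirichlet kernel: ⟨e_l, e_k⟩ = D_T(k - l). With m + 1 = 2ν
factors, the trace is therefore an integral over 2ν frequencies of the product of the densities
times a cyclic product of Dirichlet kernels (`RankOneRep.hasSum_inner`, `inner_prodFrom_W`).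
Measuring all frequencies from the first one splits this into an integral over u in ℝ^m of the
kernel product D_T(u_1) D_T(u_2 - u_1) ⋯ D_T(-u_m) against the correlation `corr` of the densities
(`integral_inner_prodFrom_W`).

Since D_T(x) = T D_1(Tx), substituting v = Tu turns (1/T) tr into the integral of a fixed kernel
against `corr` at v/T. The kernel has total mass (2π)^m, because D_1 reproduces itself under
convolution up to the factor 2π (`integral_pathProd_dirichlet`), and `corr` at 0 is the integral of
(f₁f₂)^ν. So the error is the mean of `corr`(v/T) - `corr`(0) against the kernel, and it is
O(T^(-γ)) once `corr` is γ-Hölder at 0 and the kernel has finite absolute moments of order γ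
(`norm_trace_integral_sub_le`).

The moments: D_1 decays only like 1/|x|, which is not integrable, but the cyclic product has one
more factor than variables. Giving each factor a loss of γ is affordable as long as (m + 1)γ < 1
(`integrable_pathProd`), and here 2νγ = 1 - 2ν(α₁ + α₂) < 1.

The Hölder bound: with θ_i = 2α_i + γ one has ν(θ₁ + θ₂) = 1, so Hölder's inequality applies with
f_i in L^(1/θ_i) (`abs_corr_sub_le`). For p = 1/θ_i, the power f_i^p is again a Riesz-Bessel
density, and |a - b|^p ≤ |a^p - b^p| reduces the L^p modulus of continuity of f_i to the L¹ modulus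
of f_i^p. The latter is governed by the mass near the singularity, of order |v|^(1 - 2α_i p) =
|v|^(γp) (`exists_rieszBessel_bound`). -/

noncomputable section

namespace TruncToeplitz

/-! ### Weak integrals of rank one operators: trace class property and trace. -/

section RankOne

variable {H : Type*} [NormedAddCommGroup H] [InnerProductSpace ℂ H]

/-- `A` is the weak integral `∫ f(l) |e l⟩⟨e l| dl` of rank one operators. -/
structure RankOneRep (A : H →L[ℂ] H) (f : ℝ → ℝ) (e : ℝ → H) : Prop where
  cont : ∀ v, Continuous fun l => (inner ℂ v (e l) : ℂ)
  bdd : ∃ R : ℝ, ∀ l, ‖e l‖ ≤ R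
  int : Integrable f
  rep : ∀ v u, (inner ℂ v (A u) : ℂ) =
    ∫ l, (f l : ℂ) * (inner ℂ v (e l) * inner ℂ (e l) u)

namespace RankOneRep

variable {A : H →L[ℂ] H} {f : ℝ → ℝ} {e : ℝ → H}

theorem cont_left (hA : RankOneRep A f e) (v : H) :
    Continuous fun l => (inner ℂ (e l) v : ℂ) := by
  have := Complex.continuous_conj.comp (hA.cont v)
  simpa [Function.comp_def] using this

theorem integrable (hA : RankOneRep A f e) (x y : H) :
    Integrable fun l => (f l : ℂ) * (inner ℂ x (e l) * inner ℂ (e l) y) := by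
  obtain ⟨R, hR⟩ := hA.bdd
  refine hA.int.ofReal.mul_bdd (c := (‖x‖ * R) * (R * ‖y‖))
    ((hA.cont x).mul (hA.cont_left y)).aestronglyMeasurable (.of_forall fun l => ?_)
  have hR0 : 0 ≤ R := (norm_nonneg _).trans (hR l)
  rw [norm_mul]
  refine mul_le_mul ?_ ?_ (norm_nonneg _) (by positivity)
  · exact (norm_inner_le_norm _ _).trans (mul_le_mul_of_nonneg_left (hR l) (norm_nonneg _))
  · exact (norm_inner_le_norm _ _).trans (mul_le_mul_of_nonneg_right (hR l) (norm_nonneg _))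

variable [CompleteSpace H]

theorem adjoint (hA : RankOneRep A f e) : RankOneRep (ContinuousLinearMap.adjoint A) f e where
  cont := hA.cont
  bdd := hA.bdd
  int := hA.int
  rep v u := by
    rw [ContinuousLinearMap.adjoint_inner_right, ← inner_conj_symm, hA.rep, ← integral_conj]
    refine integral_congr_ae (.of_forall fun l => ?_)
    simp only [map_mul, Complex.conj_ofReal, inner_conj_symm]
    ring

/-- Bessel and Cauchy-Schwarz, applied for each l to the adjoints of `B` and `C` at `e l`, bound
every finite partial sum by the same multiple of ∫|f|. This licenses exchanging the sum over the
basis with the integral: `C = 1` serves the trace, `C = A` and `B = 1` the Hilbert-Schmidt norm. -/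
theorem summable_integral_norm (hA : RankOneRep A f e) {ι : Type*} (b : HilbertBasis ι ℂ H)
    (C B : H →L[ℂ] H) : Summable fun i =>
      ∫ l, ‖(f l : ℂ) * (inner ℂ (C (b i)) (e l) * inner ℂ (e l) (B (b i)))‖ := by
  obtain ⟨R, hR⟩ := hA.bdd
  have hR0 : 0 ≤ R := (norm_nonneg _).trans (hR 0)
  refine summable_of_sum_le (c := ∫ l, |f l| * ((‖B‖ * R) * (‖C‖ * R)))
    (fun i => integral_nonneg fun l => norm_nonneg _) fun s => ?_
  rw [← integral_finsetSum _ fun i _ => (hA.integrable _ _).norm]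
  refine integral_mono (integrable_finsetSum _ fun i _ => (hA.integrable _ _).norm)
    (hA.int.abs.mul_const _) fun l => ?_
  obtain ⟨h1, h2⟩ := summable_and_tsum_le b (ContinuousLinearMap.adjoint B (e l))
    (ContinuousLinearMap.adjoint C (e l))
  have hle : ∀ D : H →L[ℂ] H, ‖ContinuousLinearMap.adjoint D (e l)‖ ≤ ‖D‖ * R := fun D =>
    (ContinuousLinearMap.le_opNorm _ _).trans (by
      rw [LinearIsometryEquiv.norm_map]
      exact mul_le_mul_of_nonneg_left (hR l) (norm_nonneg _))
  have h3 := (h1.sum_le_tsum s fun i _ => by positivity).trans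
    (h2.trans (mul_le_mul (hle B) (hle C) (norm_nonneg _) (by positivity)))
  simp only [norm_mul, ← Finset.mul_sum, Complex.norm_real, Real.norm_eq_abs]
  refine mul_le_mul_of_nonneg_left (le_trans (le_of_eq ?_) h3) (abs_nonneg _)
  refine Finset.sum_congr rfl fun i _ => ?_
  rw [ContinuousLinearMap.adjoint_inner_left, ContinuousLinearMap.adjoint_inner_right, mul_comm]

theorem summable_norm_sq (hA : RankOneRep A f e) {ι : Type*} (b : HilbertBasis ι ℂ H) :
    Summable fun i => ‖A (b i)‖ ^ 2 := by
  refine Summable.of_nonneg_of_le (fun i => by positivity) (fun i => ?_)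
    (hA.summable_integral_norm b A 1)
  have h := hA.rep (A (b i)) (b i)
  have h2 : ‖A (b i)‖ ^ 2 = ‖(inner ℂ (A (b i)) (A (b i)) : ℂ)‖ := by
    rw [inner_self_eq_norm_sq_to_K]; simp
  rw [h2, h]
  exact norm_integral_le_integral_norm _

/-- `tr (A B) = ∫ f(l) ⟨e l, B (e l)⟩ dl`, computed in a countable orthonormal basis. -/
theorem hasSum_inner (hA : RankOneRep A f e) {ι : Type*} [Countable ι] (b : HilbertBasis ι ℂ H)
    (B : H →L[ℂ] H) : HasSum (fun i => (inner ℂ (b i) (A (B (b i))) : ℂ))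
      (∫ l, (f l : ℂ) * inner ℂ (e l) (B (e l))) := by
  have h := hasSum_integral_of_summable_integral_norm
    (F := fun i l => (f l : ℂ) * (inner ℂ (b i) (e l) * inner ℂ (e l) (B (b i))))
    (fun i => hA.integrable _ _) (hA.summable_integral_norm b 1 B)
  rw [funext fun i => hA.rep (b i) (B (b i))]
  suffices h0 : ∫ l, (f l : ℂ) * inner ℂ (e l) (B (e l)) =
      ∫ l, ∑' i, (f l : ℂ) * (inner ℂ (b i) (e l) * inner ℂ (e l) (B (b i))) by
    rw [h0]
    exact h
  refine integral_congr_ae (.of_forall fun l => ?_)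
  simp only
  rw [tsum_mul_left]
  congr 1
  -- Parseval for the pair `B* (e l)`, `e l` sums the integrand over the basis.
  have h1 := (b.hasSum_inner_mul_inner (ContinuousLinearMap.adjoint B (e l)) (e l)).tsum_eq
  rw [ContinuousLinearMap.adjoint_inner_left] at h1
  rw [← h1]
  refine tsum_congr fun i => ?_
  rw [ContinuousLinearMap.adjoint_inner_left, mul_comm]

/-- A product of operators with `A` and `B` adjoint Hilbert-Schmidt is trace class. -/
theorem isTraceClass_mul {B : H →L[ℂ] H} (hA : RankOneRep A f e) {ι : Type*} [Countable ι]
    (b : HilbertBasis ι ℂ H)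
    (hB : Summable fun i => ‖ContinuousLinearMap.adjoint B (b i)‖ ^ 2) :
    IsTraceClass (A * B) := by
  obtain ⟨φ, hφ⟩ := exists_injective_nat ι
  -- Expanding `B u` in the basis gives A B u = ∑ ⟨B* b_i, u⟩ A b_i. The index set is injected into
  -- ℕ and both families are extended by zero; summability follows from xy ≤ x² + y².
  refine ⟨Function.extend φ (fun i => ContinuousLinearMap.adjoint B (b i)) 0,
    Function.extend φ (fun i => A (b i)) 0, ?_, fun u => ?_⟩
  · have : (fun n => ‖Function.extend φ (fun i => ContinuousLinearMap.adjoint B (b i)) 0 n‖ *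
        ‖Function.extend φ (fun i => A (b i)) 0 n‖) =
        Function.extend φ (fun i => ‖ContinuousLinearMap.adjoint B (b i)‖ * ‖A (b i)‖) 0 := by
      funext n
      by_cases hn : ∃ i, φ i = n
      · obtain ⟨i, rfl⟩ := hn
        simp [hφ.extend_apply]
      · simp [Function.extend_apply' _ _ _ hn]
    rw [this, summable_extend_zero hφ]
    refine Summable.of_nonneg_of_le (fun i => by positivity) (fun i => ?_)
      (hB.add (hA.summable_norm_sq b))
    nlinarith [sq_nonneg (‖ContinuousLinearMap.adjoint B (b i)‖ - ‖A (b i)‖),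
      sq_nonneg (‖ContinuousLinearMap.adjoint B (b i)‖ + ‖A (b i)‖)]
  · have : (fun n => (inner ℂ (Function.extend φ
        (fun i => ContinuousLinearMap.adjoint B (b i)) 0 n) u : ℂ) •
        Function.extend φ (fun i => A (b i)) 0 n) =
        Function.extend φ (fun i => (inner ℂ (b i) (B u) : ℂ) • A (b i)) 0 := by
      funext n
      by_cases hn : ∃ i, φ i = n
      · obtain ⟨i, rfl⟩ := hn
        simp [hφ.extend_apply, ContinuousLinearMap.adjoint_inner_left]
      · simp [Function.extend_apply' _ _ _ hn]
    rw [this, hasSum_extend_zero hφ]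
    have h := A.hasSum (b.hasSum_repr (B u))
    simpa [Function.comp_def, b.repr_apply_apply] using h

theorem summable_adjoint_mul_norm_sq {ι : Type*} (b : HilbertBasis ι ℂ H)
    (hA : RankOneRep A f e) (B : H →L[ℂ] H) :
    Summable fun i => ‖ContinuousLinearMap.adjoint (A * B) (b i)‖ ^ 2 := by
  refine Summable.of_nonneg_of_le (fun i => by positivity) (fun i => ?_)
    ((hA.adjoint.summable_norm_sq b).mul_left (‖ContinuousLinearMap.adjoint B‖ ^ 2))
  rw [← mul_pow, ContinuousLinearMap.mul_def, ContinuousLinearMap.adjoint_comp]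
  exact pow_le_pow_left₀ (norm_nonneg _) ((ContinuousLinearMap.adjoint B).le_opNorm _) 2

end RankOneRep

/-- Orthonormal vectors lie at distance √2, so the balls of radius 1/2 around them are disjoint open
sets, of which a second countable space holds only countably many. -/
theorem countable_of_hilbertBasis [SecondCountableTopology H] {ι : Type*}
    (b : HilbertBasis ι ℂ H) : Countable ι := by
  have hd : Pairwise (Function.onFun Disjoint fun i => Metric.ball (b i) (1 / 2)) := by
    intro i j hij
    refine Metric.ball_disjoint_ball ?_
    have h : ‖b i - b j‖ ^ 2 = 2 := by
      have := b.orthonormal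
      rw [@norm_sub_sq ℂ, this.1, this.1, this.2 hij]
      norm_num
    rw [dist_eq_norm]
    nlinarith [norm_nonneg (b i - b j)]
  exact Pairwise.countable_of_isOpen_disjoint hd (fun i => Metric.isOpen_ball)
    fun i => Metric.nonempty_ball.2 (by norm_num)

end RankOne

/-! ### The exponentials in L²[0,T] and the rank one representation of `W`. -/

section Exponentials

theorem norm_exp_I_mul_mul (l t : ℝ) : ‖Complex.exp (Complex.I * (l : ℂ) * (t : ℂ))‖ = 1 := by
  rw [Complex.norm_exp]; simp

theorem conj_exp_I_mul_mul (l t : ℝ) :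
    (starRingEnd ℂ) (Complex.exp (Complex.I * (l : ℂ) * (t : ℂ))) =
      Complex.exp (-(Complex.I * (l : ℂ) * (t : ℂ))) := by
  rw [← Complex.exp_conj]; simp

theorem memLp_exp (T l : ℝ) :
    MemLp (fun t : ℝ => Complex.exp (Complex.I * (l : ℂ) * (t : ℂ))) 2
      (volume.restrict (Set.Icc (0 : ℝ) T)) :=
  MemLp.of_bound (Continuous.aestronglyMeasurable (by fun_prop)) 1
    (.of_forall fun t => (norm_exp_I_mul_mul l t).le)

/-- The exponential `t ↦ exp(i l t)` as an element of `L²[0,T]`. -/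
def expL2 (T l : ℝ) : L2 T := (memLp_exp T l).toLp _

/-- The Dirichlet kernel `∫₀ᵀ exp(i x t) dt`. -/
def dirichlet (T x : ℝ) : ℂ :=
  ∫ t in Set.Icc (0 : ℝ) T, Complex.exp (Complex.I * (x : ℂ) * (t : ℂ))

theorem inner_expL2_right {T : ℝ} (v : L2 T) (l : ℝ) : (inner ℂ v (expL2 T l) : ℂ) =
    ∫ t in Set.Icc (0 : ℝ) T,
      Complex.exp (Complex.I * (l : ℂ) * (t : ℂ)) * (starRingEnd ℂ) (v t) := by
  rw [L2.inner_def]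
  refine integral_congr_ae ?_
  filter_upwards [(memLp_exp T l).coeFn_toLp] with t ht
  rw [RCLike.inner_apply, expL2, ht]

theorem inner_expL2_left {T : ℝ} (v : L2 T) (l : ℝ) : (inner ℂ (expL2 T l) v : ℂ) =
    ∫ t in Set.Icc (0 : ℝ) T, v t * Complex.exp (-(Complex.I * (l : ℂ) * (t : ℂ))) := by
  rw [L2.inner_def]
  refine integral_congr_ae ?_
  filter_upwards [(memLp_exp T l).coeFn_toLp] with t ht
  rw [RCLike.inner_apply, expL2, ht, conj_exp_I_mul_mul]

theorem inner_expL2_expL2 (T l k : ℝ) :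
    (inner ℂ (expL2 T l) (expL2 T k) : ℂ) = dirichlet T (k - l) := by
  rw [inner_expL2_left]
  refine integral_congr_ae ?_
  filter_upwards [(memLp_exp T k).coeFn_toLp] with t ht
  rw [expL2, ht, ← Complex.exp_add]
  push_cast
  ring_nf

theorem continuous_inner_expL2 {T : ℝ} (v : L2 T) :
    Continuous fun l => (inner ℂ v (expL2 T l) : ℂ) := by
  simp only [inner_expL2_right]
  have hv : Integrable (fun t => (starRingEnd ℂ) (v t)) (volume.restrict (Set.Icc (0 : ℝ) T)) :=
    Complex.conjLIE.toLinearIsometry.toContinuousLinearMap.integrable_comp (integrable_L2 v)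
  refine continuous_of_dominated (bound := fun t => ‖(starRingEnd ℂ) (v t)‖) (fun l => ?_)
    (fun l => .of_forall fun t => ?_) hv.norm (.of_forall fun t => by fun_prop)
  · exact (Continuous.aestronglyMeasurable (by fun_prop)).mul hv.1
  · rw [norm_mul, norm_exp_I_mul_mul, one_mul]

theorem norm_expL2_le (T l : ℝ) : ‖expL2 T l‖ ≤
    (measureUnivNNReal (volume.restrict (Set.Icc (0 : ℝ) T)) : ℝ) ^ (2 : ENNReal).toReal⁻¹ * 1 := by
  refine Lp.norm_le_of_ae_bound zero_le_one ?_
  filter_upwards [(memLp_exp T l).coeFn_toLp] with t ht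
  rw [expL2, ht]
  exact (norm_exp_I_mul_mul l t).le

/-- Fubini, after factoring exp(il(t - s)) = exp(ilt) exp(-ils). -/
theorem toeplitzFun_eq {T : ℝ} {f : ℝ → ℝ} (hf : Integrable f) (u : L2 T) (t : ℝ) :
    toeplitzFun T f u t = ∫ l, (f l : ℂ) * Complex.exp (Complex.I * (l : ℂ) * (t : ℂ)) *
      inner ℂ (expL2 T l) u := by
  have h1 : toeplitzFun T f u t = ∫ s in Set.Icc (0 : ℝ) T, ∫ l : ℝ,
      ((f l : ℂ) * u s) * (Complex.exp (Complex.I * (l : ℂ) * (t : ℂ)) *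
        Complex.exp (-(Complex.I * (l : ℂ) * (s : ℂ)))) := by
    refine integral_congr_ae (.of_forall fun s => ?_)
    simp only [fourier]
    rw [← integral_mul_const]
    refine integral_congr_ae (.of_forall fun l => ?_)
    simp only
    rw [← Complex.exp_add]
    push_cast
    ring_nf
  rw [h1, integral_integral_swap]
  · refine integral_congr_ae (.of_forall fun l => ?_)
    simp only
    rw [inner_expL2_left, ← integral_const_mul]
    refine integral_congr_ae (.of_forall fun s => ?_)
    simp only
    ring
  · have h2 := (hf.ofReal (𝕜 := ℂ)).mul_prod (integrable_L2 u)
    refine (h2.swap.mul_bdd (c := 1) (Continuous.aestronglyMeasurable (by fun_prop))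
      (.of_forall fun p => ?_) : Integrable (fun p : ℝ × ℝ => ((f p.2 : ℂ) * u p.1) *
        (Complex.exp (Complex.I * (p.2 : ℂ) * (t : ℂ)) *
        Complex.exp (-(Complex.I * (p.2 : ℂ) * (p.1 : ℂ))))) _)
    rw [norm_mul, norm_exp_I_mul_mul, ← conj_exp_I_mul_mul, RCLike.norm_conj,
      norm_exp_I_mul_mul, one_mul]

theorem rankOneRep_W (T : ℝ) {f : ℝ → ℝ} (hf : Integrable f) :
    RankOneRep (W T f) f (expL2 T) where
  cont := continuous_inner_expL2
  bdd := ⟨_, norm_expL2_le T⟩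
  int := hf
  rep v u := by
    have h1 : (inner ℂ v (W T f u) : ℂ) = ∫ t in Set.Icc (0 : ℝ) T, ∫ l : ℝ,
        ((f l : ℂ) * (starRingEnd ℂ) (v t)) * (Complex.exp (Complex.I * (l : ℂ) * (t : ℂ)) *
          inner ℂ (expL2 T l) u) := by
      rw [L2.inner_def]
      refine integral_congr_ae ?_
      filter_upwards [(memLp_toeplitzFun T f u).coeFn_toLp] with t ht
      rw [RCLike.inner_apply]
      change (MemLp.toLp _ (memLp_toeplitzFun T f u)) t * _ = _
      rw [ht, toeplitzFun_eq hf, ← integral_mul_const]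
      refine integral_congr_ae (.of_forall fun l => ?_)
      simp only
      ring
    rw [h1, integral_integral_swap]
    · refine integral_congr_ae (.of_forall fun l => ?_)
      simp only
      rw [inner_expL2_right, ← integral_mul_const, ← integral_const_mul]
      refine integral_congr_ae (.of_forall fun s => ?_)
      simp only
      ring
    · have hv : Integrable (fun t => (starRingEnd ℂ) (v t))
          (volume.restrict (Set.Icc (0 : ℝ) T)) :=
        Complex.conjLIE.toLinearIsometry.toContinuousLinearMap.integrable_comp (integrable_L2 v)
      have hc : Continuous fun l => (inner ℂ (expL2 T l) u : ℂ) := by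
        have := Complex.continuous_conj.comp (continuous_inner_expL2 u)
        simpa [Function.comp_def] using this
      have h2 := (hf.ofReal (𝕜 := ℂ)).mul_prod hv
      refine (h2.swap.mul_bdd (c := ((measureUnivNNReal (volume.restrict (Set.Icc (0 : ℝ) T)) : ℝ) ^
        (2 : ENNReal).toReal⁻¹ * 1) * ‖u‖) (Continuous.aestronglyMeasurable ((by fun_prop : Continuous
          fun p : ℝ × ℝ => Complex.exp (Complex.I * (p.2 : ℂ) * (p.1 : ℂ))).mul
          (hc.comp continuous_snd)))
        (.of_forall fun p => ?_) : Integrable (fun p : ℝ × ℝ =>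
          ((f p.2 : ℂ) * (starRingEnd ℂ) (v p.1)) *
          (Complex.exp (Complex.I * (p.2 : ℂ) * (p.1 : ℂ)) * inner ℂ (expL2 T p.2) u)) _)
      rw [norm_mul, norm_exp_I_mul_mul, one_mul]
      exact (norm_inner_le_norm _ _).trans
        (mul_le_mul_of_nonneg_right (norm_expL2_le T _) (norm_nonneg _))

end Exponentials

/-! ### Products over the increments of a path. -/

section Paths

/-! Integration over `Fin (m + 1) → ℝ`. -/

theorem measurePreserving_cons (m : ℕ) :
    MeasurePreserving (fun p : ℝ × (Fin m → ℝ) => (Fin.cons p.1 p.2 : Fin (m + 1) → ℝ)) := by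
  have h := (volume_preserving_piFinSuccAbove (fun _ : Fin (m + 1) => ℝ) 0).symm
  convert h using 1
  funext p
  simp [MeasurableEquiv.piFinSuccAbove, Fin.insertNthEquiv]

theorem measurableEmbedding_cons (m : ℕ) :
    MeasurableEmbedding (fun p : ℝ × (Fin m → ℝ) => (Fin.cons p.1 p.2 : Fin (m + 1) → ℝ)) := by
  have h := (MeasurableEquiv.piFinSuccAbove (fun _ : Fin (m + 1) => ℝ) 0).symm.measurableEmbedding
  convert h using 1
  funext p
  simp [MeasurableEquiv.piFinSuccAbove, Fin.insertNthEquiv]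

theorem integral_cons {m : ℕ} {F : (Fin (m + 1) → ℝ) → ℂ} (hF : Integrable F) :
    ∫ x, F x = ∫ a : ℝ, ∫ y : Fin m → ℝ, F (Fin.cons a y) := by
  rw [← (measurePreserving_cons m).integral_comp (measurableEmbedding_cons m) F]
  exact integral_prod _ ((measurePreserving_cons m).integrable_comp_of_integrable hF)

theorem lintegral_cons {m : ℕ} {F : (Fin (m + 1) → ℝ) → ENNReal} (hF : Measurable F) :
    ∫⁻ x, F x = ∫⁻ a : ℝ, ∫⁻ y : Fin m → ℝ, F (Fin.cons a y) := by
  rw [← (measurePreserving_cons m).lintegral_comp hF]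
  exact lintegral_prod _ (hF.comp (measurableEmbedding_cons m).measurable).aemeasurable

/-- The product of `φ` over the increments of the path `a, x 0, …, x (m - 1), b`. -/
def pathProd {R : Type*} [Mul R] (φ : ℝ → R) : (m : ℕ) → ℝ → (Fin m → ℝ) → ℝ → R
  | 0, a, _, b => φ (b - a)
  | m + 1, a, x, b => φ (x 0 - a) * pathProd φ m (x 0) (Fin.tail x) b

theorem pathProd_cons {R : Type*} [Mul R] (φ : ℝ → R) (m : ℕ) (a c : ℝ) (x : Fin m → ℝ) (b : ℝ) :
    pathProd φ (m + 1) a (Fin.cons c x) b = φ (c - a) * pathProd φ m c x b := by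
  simp [pathProd]

theorem pathProd_add {R : Type*} [Mul R] (φ : ℝ → R) (m : ℕ) (a : ℝ) (x : Fin m → ℝ) (b c : ℝ) :
    pathProd φ m (a + c) (fun j => x j + c) (b + c) = pathProd φ m a x b := by
  induction m generalizing a with
  | zero => simp [pathProd]
  | succ m ih =>
    simp only [pathProd, add_sub_add_right_eq_sub]
    rw [← ih (x 0) (Fin.tail x)]
    rfl

theorem pathProd_smul {R : Type*} [CommSemiring R] (φ : ℝ → R) (r : R) (c : ℝ) (m : ℕ) (a : ℝ)
    (x : Fin m → ℝ) (b : ℝ) :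
    pathProd (fun t => r * φ (c * t)) m a x b =
      r ^ (m + 1) * pathProd φ m (c * a) (c • x) (c * b) := by
  induction m generalizing a with
  | zero => simp [pathProd, mul_sub]
  | succ m ih =>
    simp only [pathProd]
    rw [ih]
    have : Fin.tail (c • x) = c • Fin.tail x := rfl
    rw [this]
    simp only [Pi.smul_apply, smul_eq_mul, mul_sub]
    ring

theorem continuous_pathProd {R : Type*} [TopologicalSpace R] [Mul R] [ContinuousMul R]
    {φ : ℝ → R} (hφ : Continuous φ) (m : ℕ) :
    Continuous fun p : ℝ × (Fin m → ℝ) × ℝ => pathProd φ m p.1 p.2.1 p.2.2 := by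
  induction m with
  | zero => simp only [pathProd]; fun_prop
  | succ m ih =>
    simp only [pathProd]
    refine (hφ.comp (by fun_prop)).mul ?_
    exact ih.comp (f := fun p : ℝ × (Fin (m + 1) → ℝ) × ℝ => (p.2.1 0, Fin.tail p.2.1, p.2.2))
      (by unfold Fin.tail; fun_prop)

theorem norm_pathProd (φ : ℝ → ℂ) (m : ℕ) (a : ℝ) (x : Fin m → ℝ) (b : ℝ) :
    ‖pathProd φ m a x b‖ = pathProd (fun t => ‖φ t‖) m a x b := by
  induction m generalizing a with
  | zero => rfl
  | succ m ih => simp only [pathProd, norm_mul, ih]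

theorem pathProd_nonneg {φ : ℝ → ℝ} (hφ : ∀ t, 0 ≤ φ t) (m : ℕ) (a : ℝ) (x : Fin m → ℝ) (b : ℝ) :
    0 ≤ pathProd φ m a x b := by
  induction m generalizing a with
  | zero => exact hφ _
  | succ m ih => exact mul_nonneg (hφ _) (ih _ _)

theorem pathProd_mono {φ ψ : ℝ → ℝ} (hφ : ∀ t, 0 ≤ φ t) (h : ∀ t, φ t ≤ ψ t) (m : ℕ) (a : ℝ)
    (x : Fin m → ℝ) (b : ℝ) : pathProd φ m a x b ≤ pathProd ψ m a x b := by
  induction m generalizing a with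
  | zero => exact h _
  | succ m ih =>
    exact mul_le_mul (h _) (ih _ _) (pathProd_nonneg hφ _ _ _ _) ((hφ _).trans (h _))

theorem pathProd_const_mul (c : ℝ) (φ : ℝ → ℝ) (m : ℕ) (a : ℝ) (x : Fin m → ℝ) (b : ℝ) :
    pathProd (fun t => c * φ t) m a x b = c ^ (m + 1) * pathProd φ m a x b := by
  have := pathProd_smul φ c 1 m a x b
  simpa using this

theorem norm_pathProd_le {φ : ℝ → ℂ} {c : ℝ} {ψ : ℝ → ℝ} (h : ∀ t, ‖φ t‖ ≤ c * ψ t) (m : ℕ)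
    (a : ℝ) (x : Fin m → ℝ) (b : ℝ) :
    ‖pathProd φ m a x b‖ ≤ c ^ (m + 1) * pathProd ψ m a x b := by
  rw [norm_pathProd, ← pathProd_const_mul]
  exact pathProd_mono (fun t => norm_nonneg _) h m a x b

/-- A power weight at an intermediate point of the path is absorbed by the increments. -/
theorem weight_mul_pathProd_le {γ : ℝ} (hγ : 0 ≤ γ) {φ : ℝ → ℝ} (hφ : ∀ t, 0 ≤ φ t) (m : ℕ) (a : ℝ)
    (x : Fin m → ℝ) (b : ℝ) (j : Fin m) :
    (1 + |x j - a|) ^ γ * pathProd φ m a x b ≤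
      pathProd (fun t => (1 + |t|) ^ γ * φ t) m a x b := by
  have h1 : ∀ t : ℝ, 1 ≤ (1 + |t|) ^ γ := fun t =>
    Real.one_le_rpow (by linarith [abs_nonneg t]) hγ
  have hle : ∀ t, φ t ≤ (1 + |t|) ^ γ * φ t := fun t => le_mul_of_one_le_left (hφ t) (h1 t)
  have hn : ∀ t, 0 ≤ (1 + |t|) ^ γ * φ t := fun t => (hφ t).trans (hle t)
  induction m generalizing a with
  | zero => exact j.elim0
  | succ m ih =>
    simp only [pathProd]
    refine Fin.cases ?_ (fun i => ?_) j
    · rw [← mul_assoc]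
      exact mul_le_mul_of_nonneg_left (pathProd_mono hφ hle m _ _ _) (hn _)
    -- Submultiplicativity: 1 + |p + q| ≤ (1 + |p|)(1 + |q|).
    · have h2 : (1 + |x i.succ - a|) ^ γ ≤
          (1 + |x 0 - a|) ^ γ * (1 + |x i.succ - x 0|) ^ γ := by
        rw [← Real.mul_rpow (by positivity) (by positivity)]
        refine Real.rpow_le_rpow (by positivity) ?_ hγ
        have := abs_sub_le (x i.succ) (x 0) a
        nlinarith [mul_nonneg (abs_nonneg (x 0 - a)) (abs_nonneg (x i.succ - x 0))]
      calc (1 + |x i.succ - a|) ^ γ * (φ (x 0 - a) * pathProd φ m (x 0) (Fin.tail x) b)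
          ≤ ((1 + |x 0 - a|) ^ γ * (1 + |x i.succ - x 0|) ^ γ) *
              (φ (x 0 - a) * pathProd φ m (x 0) (Fin.tail x) b) :=
            mul_le_mul_of_nonneg_right h2 (mul_nonneg (hφ _) (pathProd_nonneg hφ _ _ _ _))
        _ = ((1 + |x 0 - a|) ^ γ * φ (x 0 - a)) *
              ((1 + |Fin.tail x i - x 0|) ^ γ * pathProd φ m (x 0) (Fin.tail x) b) := by
            rw [Fin.tail]; ring
        _ ≤ _ := mul_le_mul_of_nonneg_left (ih (x 0) (Fin.tail x) i) (hn _)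

end Paths

/-! ### Decay of iterated convolutions of powers of 1 + |x|. -/

section Decay

/-- The larger of `X` and `Y` is at least `Z / 2`, so a part `c` of its exponent pays for `Z ^
(-c)`; the rest of its decay is at most the corresponding power of the smaller one. -/
theorem rpow_neg_mul_rpow_neg_le {a b c X Y Z : ℝ} (hX : 1 ≤ X) (hY : 1 ≤ Y) (hZ : 1 ≤ Z)
    (hc : 0 ≤ c) (hca : c ≤ a) (hcb : c ≤ b) (h : Z ≤ X + Y) :
    X ^ (-a) * Y ^ (-b) ≤ 2 ^ c * Z ^ (-c) * (X ^ (-(a + b - c)) + Y ^ (-(a + b - c))) := by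
  have key : ∀ {a b X Y : ℝ}, 1 ≤ X → 1 ≤ Y → c ≤ a → Z ≤ X + Y → Y ≤ X →
      X ^ (-a) * Y ^ (-b) ≤ 2 ^ c * Z ^ (-c) * Y ^ (-(a + b - c)) := by
    intro a b X Y hX hY hca h hYX
    have hX0 : 0 < X := by linarith
    have hY0 : 0 < Y := by linarith
    have e1 : X ^ (-a) = X ^ (-c) * X ^ (-(a - c)) := by
      rw [← Real.rpow_add hX0]; ring_nf
    have e2 : Y ^ (-(a + b - c)) = Y ^ (-(a - c)) * Y ^ (-b) := by
      rw [← Real.rpow_add hY0]; ring_nf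
    have e3 : X ^ (-c) ≤ 2 ^ c * Z ^ (-c) := by
      have : (2 * X) ^ (-c) ≤ Z ^ (-c) :=
        Real.rpow_le_rpow_of_nonpos (by linarith) (by linarith) (by linarith)
      rw [Real.mul_rpow (by norm_num) hX0.le] at this
      calc X ^ (-c) = 2 ^ c * (2 ^ (-c) * X ^ (-c)) := by
            rw [← mul_assoc, ← Real.rpow_add (by norm_num)]; simp
        _ ≤ _ := mul_le_mul_of_nonneg_left this (by positivity)
    have e4 : X ^ (-(a - c)) ≤ Y ^ (-(a - c)) :=
      Real.rpow_le_rpow_of_nonpos hY0 hYX (by linarith)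
    rw [e1, e2, ← mul_assoc]
    refine mul_le_mul_of_nonneg_right ?_ (by positivity)
    exact mul_le_mul e3 e4 (by positivity) (by positivity)
  have hX0 : 0 < X := by linarith
  have hY0 : 0 < Y := by linarith
  have hZ0 : 0 < Z := by linarith
  have p1 : 0 ≤ 2 ^ c * Z ^ (-c) * X ^ (-(a + b - c)) := by positivity
  have p2 : 0 ≤ 2 ^ c * Z ^ (-c) * Y ^ (-(a + b - c)) := by positivity
  rw [mul_add]
  rcases le_total Y X with hYX | hXY
  · linarith [key (b := b) hX hY hca h hYX]
  · have := key (b := a) hY hX hcb (by linarith) hXY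
    rw [mul_comm (Y ^ (-b)), add_comm b a] at this
    linarith

/-- Convolutions of powers of `1 + |x|`. -/
theorem exists_lintegral_conv_le {a b c : ℝ} (hc : 0 ≤ c) (hca : c ≤ a) (hcb : c ≤ b)
    (h : 1 < a + b - c) : ∃ K : ℝ, 0 ≤ K ∧ ∀ u v : ℝ,
      ∫⁻ x : ℝ, ENNReal.ofReal ((1 + |x - u|) ^ (-a) * (1 + |v - x|) ^ (-b)) ≤
        ENNReal.ofReal (K * (1 + |v - u|) ^ (-c)) := by
  have hint : Integrable fun x : ℝ => (1 + |x|) ^ (-(a + b - c)) := by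
    have := integrable_one_add_norm (E := ℝ) (μ := volume) (r := a + b - c) (by simpa using h)
    simpa using this
  refine ⟨2 ^ c * (2 * ∫ x : ℝ, (1 + |x|) ^ (-(a + b - c))), ?_, fun u v => ?_⟩
  · have : 0 ≤ ∫ x : ℝ, (1 + |x|) ^ (-(a + b - c)) := integral_nonneg fun x => by positivity
    positivity
  · have h1 := hint.comp_sub_right u
    have h2 := hint.comp_sub_left v
    have h3 : ∫ x : ℝ, ((1 + |x - u|) ^ (-(a + b - c)) + (1 + |v - x|) ^ (-(a + b - c))) =
        2 * ∫ x : ℝ, (1 + |x|) ^ (-(a + b - c)) := by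
      rw [integral_add h1 h2,
        integral_sub_right_eq_self (fun x : ℝ => (1 + |x|) ^ (-(a + b - c))) u,
        integral_sub_left_eq_self (fun x : ℝ => (1 + |x|) ^ (-(a + b - c))) volume v]
      ring
    have h4 := (h1.add h2).const_mul (2 ^ c * (1 + |v - u|) ^ (-c))
    simp only [Pi.add_apply] at h4
    calc _ ≤ ∫⁻ x : ℝ, ENNReal.ofReal (2 ^ c * (1 + |v - u|) ^ (-c) *
            ((1 + |x - u|) ^ (-(a + b - c)) + (1 + |v - x|) ^ (-(a + b - c)))) := by
          refine lintegral_mono fun x => ENNReal.ofReal_le_ofReal ?_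
          refine rpow_neg_mul_rpow_neg_le ?_ ?_ ?_ hc hca hcb ?_
          · linarith [abs_nonneg (x - u)]
          · linarith [abs_nonneg (v - x)]
          · linarith [abs_nonneg (v - u)]
          · linarith [abs_sub_le v x u]
      _ = _ := by
          rw [← ofReal_integral_eq_lintegral_ofReal h4 (.of_forall fun x => by
            simp only [Pi.zero_apply]; positivity)]
          rw [integral_const_mul, h3]
          ring_nf

/-- The iterated convolution of `(1 + |x|) ^ (γ - 1)`. -/
theorem exists_lintegral_pathProd_le {γ s : ℝ} (hγ : 0 ≤ γ) (hs : γ < s) (m : ℕ)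
    (hm : (m + 1) * s ≤ 1) : ∃ K : ℝ, 0 ≤ K ∧ ∀ a b : ℝ,
      ∫⁻ x : Fin m → ℝ, ENNReal.ofReal (pathProd (fun t => (1 + |t|) ^ (-(1 - γ))) m a x b) ≤
        ENNReal.ofReal (K * (1 + |b - a|) ^ (-(1 - (m + 1) * s))) := by
  have hcont : Continuous fun t : ℝ => (1 + |t|) ^ (-(1 - γ)) :=
    (by fun_prop : Continuous fun t : ℝ => 1 + |t|).rpow_const fun t =>
      Or.inl (by positivity)
  have hpos : ∀ t : ℝ, 0 ≤ (1 + |t|) ^ (-(1 - γ)) := fun t => by positivity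
  induction m with
  | zero =>
    refine ⟨1, zero_le_one, fun a b => ?_⟩
    simp only [pathProd, lintegral_const, one_mul, Nat.cast_zero, zero_add]
    have : (volume : Measure (Fin 0 → ℝ)) Set.univ = 1 := by
      simp [volume_pi]
    rw [this, mul_one]
    refine ENNReal.ofReal_le_ofReal (Real.rpow_le_rpow_of_exponent_le ?_ (by linarith))
    linarith [abs_nonneg (b - a)]
  | succ m ih =>
    push_cast at hm
    have hs0 : 0 < s := hγ.trans_lt hs
    have hmn : (0 : ℝ) ≤ m := Nat.cast_nonneg m
    obtain ⟨K, hK, hKle⟩ := ih (by nlinarith)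
    -- Here a + b - c = 1 + (s - γ): the strict inequality `γ < s` is what makes each convolution
    -- converge, at the price of losing `s` in the decay exponent.
    obtain ⟨K', hK', hKle'⟩ := exists_lintegral_conv_le (a := 1 - γ) (b := 1 - (m + 1) * s)
      (c := 1 - (m + 1 + 1) * s) (by linarith) (by nlinarith) (by nlinarith) (by nlinarith)
    refine ⟨K * K', by positivity, fun a b => ?_⟩
    rw [lintegral_cons]
    · simp only [pathProd_cons]
      calc _ ≤ ∫⁻ c : ℝ, ENNReal.ofReal K * ENNReal.ofReal ((1 + |c - a|) ^ (-(1 - γ)) *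
              (1 + |b - c|) ^ (-(1 - (m + 1) * s))) := by
            refine lintegral_mono fun c => ?_
            simp only
            simp_rw [ENNReal.ofReal_mul (hpos _)]
            rw [lintegral_const_mul']
            · refine (mul_le_mul_right (hKle c b) _).trans (le_of_eq ?_)
              rw [ENNReal.ofReal_mul hK]
              ring
            · exact ENNReal.ofReal_ne_top
        _ ≤ _ := by
            rw [lintegral_const_mul' _ _ ENNReal.ofReal_ne_top]
            refine (mul_le_mul_right (hKle' a b) _).trans (le_of_eq ?_)
            rw [← ENNReal.ofReal_mul hK, ← mul_assoc]
            push_cast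
            rfl
    · exact ENNReal.measurable_ofReal.comp ((continuous_pathProd hcont (m + 1)).comp
        (by fun_prop : Continuous fun x : Fin (m + 1) → ℝ => (a, x, b))).measurable

theorem integrable_pathProd {γ : ℝ} (hγ : 0 ≤ γ) (m : ℕ) (hm : (m + 1) * γ < 1) (a b : ℝ) :
    Integrable fun x : Fin m → ℝ => pathProd (fun t => (1 + |t|) ^ (-(1 - γ))) m a x b := by
  have hcont : Continuous fun t : ℝ => (1 + |t|) ^ (-(1 - γ)) :=
    (by fun_prop : Continuous fun t : ℝ => 1 + |t|).rpow_const fun t =>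
      Or.inl (by positivity)
  have hm0 : (0 : ℝ) < m + 1 := by positivity
  -- The largest admissible `s`: all decay in `b - a` is spent and a uniform finite bound remains.
  obtain ⟨K, -, hK⟩ := exists_lintegral_pathProd_le hγ (s := 1 / (m + 1))
    (by rw [lt_div_iff₀ hm0]; linarith) m (by field_simp; exact le_rfl)
  refine ⟨((continuous_pathProd hcont m).comp
    (by fun_prop : Continuous fun x : Fin m → ℝ => (a, x, b))).aestronglyMeasurable, ?_⟩
  rw [hasFiniteIntegral_iff_ofReal (.of_forall fun x => pathProd_nonneg (fun t => by positivity)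
    _ _ _ _)]
  exact (hK a b).trans_lt ENNReal.ofReal_lt_top

end Decay

/-! ### The Dirichlet kernel: scaling, decay, reproduction under convolution. -/

section Dirichlet

theorem norm_dirichlet_le {T : ℝ} (hT : 0 ≤ T) (x : ℝ) : ‖dirichlet T x‖ ≤ T := by
  refine (norm_integral_le_integral_norm _).trans (le_of_eq ?_)
  simp [norm_exp_I_mul_mul, hT]

theorem continuous_dirichlet (T : ℝ) : Continuous (dirichlet T) := by
  refine continuous_of_dominated (bound := fun _ => 1) (fun x => ?_)
    (fun x => .of_forall fun t => (norm_exp_I_mul_mul x t).le) (integrable_const _)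
    (.of_forall fun t => by fun_prop)
  exact Continuous.aestronglyMeasurable (by fun_prop)

theorem dirichlet_eq_intervalIntegral {T : ℝ} (hT : 0 ≤ T) (x : ℝ) :
    dirichlet T x = ∫ t in (0 : ℝ)..T, Complex.exp (Complex.I * (x : ℂ) * (t : ℂ)) := by
  rw [intervalIntegral.integral_of_le hT, dirichlet, integral_Icc_eq_integral_Ioc]

theorem dirichlet_eq_mul {T : ℝ} (hT : 0 < T) (x : ℝ) :
    dirichlet T x = (T : ℂ) * dirichlet 1 (T * x) := by
  rw [dirichlet_eq_intervalIntegral hT.le, dirichlet_eq_intervalIntegral zero_le_one]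
  have h := intervalIntegral.integral_comp_mul_left (a := 0) (b := 1)
    (fun t : ℝ => Complex.exp (Complex.I * (x : ℂ) * (t : ℂ))) hT.ne'
  rw [mul_zero, mul_one] at h
  have h2 : ∫ t in (0 : ℝ)..1, Complex.exp (Complex.I * ((T * x : ℝ) : ℂ) * (t : ℂ)) =
      ∫ t in (0 : ℝ)..1, Complex.exp (Complex.I * (x : ℂ) * ((T * t : ℝ) : ℂ)) := by
    congr 1
    funext t
    push_cast
    ring_nf
  rw [h2, h, Complex.real_smul, ← mul_assoc, Complex.ofReal_inv,
    mul_inv_cancel₀ (Complex.ofReal_ne_zero.2 hT.ne'), one_mul]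

/-- The constant 3 adds the trivial bound |D_1(x)| ≤ 1 to |x||D_1(x)| ≤ 2, which comes from
integrating the exponential. -/
theorem norm_dirichlet_one_le (x : ℝ) : ‖dirichlet 1 x‖ ≤ 3 * (1 + |x|)⁻¹ := by
  have h1 := norm_dirichlet_le zero_le_one x
  have h2 : |x| * ‖dirichlet 1 x‖ ≤ 2 := by
    rcases eq_or_ne x 0 with rfl | hx
    · simp
    · have hc : Complex.I * (x : ℂ) ≠ 0 := by simp [hx]
      rw [dirichlet_eq_intervalIntegral zero_le_one, integral_exp_mul_complex hc, norm_div,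
        norm_mul, Complex.norm_I, one_mul, Complex.norm_real, Real.norm_eq_abs,
        mul_div_cancel₀ _ (abs_ne_zero.2 hx)]
      refine (norm_sub_le _ _).trans ?_
      rw [norm_exp_I_mul_mul, norm_exp_I_mul_mul]
      norm_num
  have h3 : 0 < 1 + |x| := by positivity
  rw [← div_eq_mul_inv, le_div_iff₀ h3]
  linarith

theorem norm_dirichlet_one_le_rpow {γ : ℝ} (hγ : 0 ≤ γ) (x : ℝ) :
    ‖dirichlet 1 x‖ ≤ 3 * (1 + |x|) ^ (-(1 - γ)) := by
  refine (norm_dirichlet_one_le x).trans ?_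
  rw [← Real.rpow_neg_one]
  refine mul_le_mul_of_nonneg_left (Real.rpow_le_rpow_of_exponent_le ?_ (by linarith))
    (by norm_num)
  linarith [abs_nonneg x]

theorem weighted_norm_dirichlet_one_le (γ x : ℝ) :
    (1 + |x|) ^ γ * ‖dirichlet 1 x‖ ≤ 3 * (1 + |x|) ^ (-(1 - γ)) := by
  have h3 : 0 < 1 + |x| := by positivity
  refine (mul_le_mul_of_nonneg_left (norm_dirichlet_one_le x) (by positivity)).trans (le_of_eq ?_)
  rw [show -(1 - γ) = γ + (-1) by ring, Real.rpow_add h3, Real.rpow_neg_one]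
  ring

/-- The Dirichlet kernel reproduces itself under convolution. -/
theorem integral_dirichlet_mul_dirichlet (l m : ℝ) :
    ∫ k : ℝ, dirichlet 1 (k - l) * dirichlet 1 (m - k) = 2 * Real.pi * dirichlet 1 (m - l) := by
  -- The Fourier transforms of the truncated exponentials `a` and `b` at ξ are the two Dirichlet
  -- factors at k = -2πξ. The claim is then Fourier inversion for their convolution at the point 0,
  -- the change of variables giving 2π.
  let a : ℝ → ℂ := (Set.Icc (0 : ℝ) 1).indicator fun t => Complex.exp (Complex.I * ((-l : ℝ) : ℂ) * t)
  let b : ℝ → ℂ := (Set.Icc (-1 : ℝ) 0).indicator fun t =>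
    Complex.exp (Complex.I * ((-m : ℝ) : ℂ) * t)
  have ha : Integrable a := (integrable_indicator_iff measurableSet_Icc).2
    ((by fun_prop : Continuous fun t : ℝ =>
      Complex.exp (Complex.I * ((-l : ℝ) : ℂ) * t)).integrableOn_Icc)
  have hb : Integrable b := (integrable_indicator_iff measurableSet_Icc).2
    ((by fun_prop : Continuous fun t : ℝ =>
      Complex.exp (Complex.I * ((-m : ℝ) : ℂ) * t)).integrableOn_Icc)
  have hb1 : ∀ t, ‖b t‖ ≤ 1 := fun t => by
    refine (norm_indicator_le_norm_self _ _).trans ?_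
    rw [norm_exp_I_mul_mul]
  have hneg : ∀ t : ℝ, t ∈ Set.Icc (0 : ℝ) 1 → -t ∈ Set.Icc (-1 : ℝ) 0 := fun t ht =>
    ⟨by linarith [ht.2], by linarith [ht.1]⟩
  have hneg' : ∀ t : ℝ, t ∉ Set.Icc (0 : ℝ) 1 → -t ∉ Set.Icc (-1 : ℝ) 0 := fun t ht h =>
    ht ⟨by linarith [h.2], by linarith [h.1]⟩
  have hFa : ∀ ξ, FourierTransform.fourier a ξ = dirichlet 1 (-(2 * Real.pi) * ξ - l) := fun ξ => by
    rw [Real.fourier_real_eq_integral_exp_smul, dirichlet, ← integral_indicator measurableSet_Icc]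
    congr 1
    funext t
    by_cases ht : t ∈ Set.Icc (0 : ℝ) 1
    · simp only [a, Set.indicator_of_mem ht, smul_eq_mul, ← Complex.exp_add]
      push_cast
      ring_nf
    · simp only [a, Set.indicator_of_notMem ht, smul_zero]
  have hFb : ∀ ξ, FourierTransform.fourier b ξ = dirichlet 1 (m - -(2 * Real.pi) * ξ) := fun ξ => by
    rw [Real.fourier_real_eq_integral_exp_smul, dirichlet, ← integral_indicator measurableSet_Icc,
      ← integral_neg_eq_self]
    congr 1
    funext t
    by_cases ht : t ∈ Set.Icc (0 : ℝ) 1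
    · simp only [b, Set.indicator_of_mem ht, Set.indicator_of_mem (hneg t ht), smul_eq_mul,
        ← Complex.exp_add]
      push_cast
      ring_nf
    · simp only [b, Set.indicator_of_notMem ht, Set.indicator_of_notMem (hneg' t ht), smul_zero]
  have hF : FourierTransform.fourier (convolution a b (ContinuousLinearMap.mul ℂ ℂ) volume) =
      fun ξ => dirichlet 1 (-(2 * Real.pi) * ξ - l) * dirichlet 1 (m - -(2 * Real.pi) * ξ) := by
    funext ξ
    rw [Real.fourier_mul_convolution_eq ha hb, hFa, hFb]
  have hDD : Integrable fun k => dirichlet 1 (k - l) * dirichlet 1 (m - k) := by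
    obtain ⟨K, -, hK⟩ := exists_lintegral_conv_le (a := 1) (b := 1) (c := 0) le_rfl (by norm_num)
      (by norm_num) (by norm_num)
    have hg : Integrable fun x : ℝ => (1 + |x - l|) ^ (-1 : ℝ) * (1 + |m - x|) ^ (-1 : ℝ) := by
      refine ⟨Continuous.aestronglyMeasurable ?_, ?_⟩
      · exact ((by fun_prop : Continuous fun x : ℝ => 1 + |x - l|).rpow_const fun t =>
          Or.inl (by positivity)).mul ((by fun_prop : Continuous fun x : ℝ =>
          1 + |m - x|).rpow_const fun t => Or.inl (by positivity))
      · rw [hasFiniteIntegral_iff_ofReal (.of_forall fun x => by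
          simp only [Pi.zero_apply]; positivity)]
        exact (hK l m).trans_lt ENNReal.ofReal_lt_top
    refine (hg.const_mul 9).mono' (Continuous.aestronglyMeasurable ?_) (.of_forall fun x => ?_)
    · exact ((continuous_dirichlet 1).comp (by fun_prop)).mul
        ((continuous_dirichlet 1).comp (by fun_prop))
    · rw [norm_mul, Real.rpow_neg_one, Real.rpow_neg_one]
      refine (mul_le_mul (norm_dirichlet_one_le _) (norm_dirichlet_one_le _) (norm_nonneg _)
        (by positivity)).trans (le_of_eq ?_)
      ring
  -- Pointwise inversion needs continuity at 0. The jumps of `b` at -1 and 0 affect only t = 1 and t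
  -- = 0, a null set, so dominated convergence applies.
  have hcont : ContinuousAt (convolution a b (ContinuousLinearMap.mul ℂ ℂ) volume) 0 := by
    refine continuousAt_of_dominated (bound := fun t => ‖a t‖) (.of_forall fun x => ?_)
      (.of_forall fun x => .of_forall fun t => ?_) ha.norm ?_
    · exact ha.1.mul (hb.comp_sub_left x).1
    · simp only [ContinuousLinearMap.mul_apply', norm_mul]
      exact mul_le_of_le_one_right (norm_nonneg _) (hb1 _)
    · have h0 : ({0, 1} : Set ℝ)ᶜ ∈ ae (volume : Measure ℝ) :=
        compl_mem_ae_iff.2 ((Set.toFinite _).measure_zero _)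
      filter_upwards [h0] with t ht
      refine ContinuousAt.mul continuousAt_const ?_
      refine ContinuousAt.comp (f := fun x => x - t) (g := b) ?_ (by fun_prop)
      refine ContinuousOn.continuousAt_indicator (Continuous.continuousOn (by fun_prop)) ?_
      rw [frontier_Icc (by norm_num)]
      simp only [Set.mem_compl_iff, Set.mem_insert_iff, Set.mem_singleton_iff, not_or] at ht ⊢
      exact ⟨fun h => ht.2 (by linarith), fun h => ht.1 (by linarith)⟩
  have hconv : convolution a b (ContinuousLinearMap.mul ℂ ℂ) volume 0 = dirichlet 1 (m - l) := by
    rw [dirichlet, ← integral_indicator measurableSet_Icc, convolution]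
    congr 1
    funext t
    rw [ContinuousLinearMap.mul_apply', zero_sub]
    by_cases ht : t ∈ Set.Icc (0 : ℝ) 1
    · simp only [a, b, Set.indicator_of_mem ht, Set.indicator_of_mem (hneg t ht),
        ← Complex.exp_add]
      push_cast
      ring_nf
    · simp only [a, Set.indicator_of_notMem ht, zero_mul]
  have hpi : -(2 * Real.pi) ≠ 0 := by simp [Real.pi_ne_zero]
  have h := (ha.integrable_convolution (ContinuousLinearMap.mul ℂ ℂ) hb).fourierInv_fourier_eq
    (by rw [hF]; exact (hDD.comp_mul_left' hpi)) hcont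
  rw [hF, hconv, Real.fourierInv_eq'] at h
  simp only [inner_zero_right, mul_zero, Complex.ofReal_zero, zero_mul, Complex.exp_zero,
    one_smul] at h
  rw [Measure.integral_comp_mul_left
    (fun k => dirichlet 1 (k - l) * dirichlet 1 (m - k)) (-(2 * Real.pi))] at h
  rw [← h, Complex.real_smul, ← mul_assoc]
  have : |(-(2 * Real.pi))⁻¹| = (2 * Real.pi)⁻¹ := by
    rw [abs_inv, abs_neg, abs_of_pos Real.two_pi_pos]
  rw [this]
  push_cast
  rw [mul_inv_cancel₀ (by simp [Real.pi_ne_zero]), one_mul]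

theorem integrable_pathProd_dirichlet (m : ℕ) (l k : ℝ) :
    Integrable fun x : Fin m → ℝ => pathProd (dirichlet 1) m l x k := by
  refine ((integrable_pathProd le_rfl m (by simp) l k).const_mul (3 ^ (m + 1))).mono'
    ((continuous_pathProd (continuous_dirichlet 1) m).comp
      (by fun_prop : Continuous fun x : Fin m → ℝ => (l, x, k))).aestronglyMeasurable
    (.of_forall fun x => norm_pathProd_le (norm_dirichlet_one_le_rpow le_rfl) m l x k)

theorem integral_pathProd_dirichlet (m : ℕ) (l k : ℝ) :
    ∫ x : Fin m → ℝ, pathProd (dirichlet 1) m l x k = (2 * Real.pi) ^ m * dirichlet 1 (k - l) := by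
  induction m generalizing l with
  | zero =>
    simp [pathProd, volume_pi, measureReal_def]
  | succ m ih =>
    rw [integral_cons (integrable_pathProd_dirichlet (m + 1) l k)]
    simp only [pathProd_cons]
    have : ∀ c : ℝ, ∫ x : Fin m → ℝ, dirichlet 1 (c - l) * pathProd (dirichlet 1) m c x k =
        (2 * Real.pi) ^ m * (dirichlet 1 (c - l) * dirichlet 1 (k - c)) := fun c => by
      rw [integral_const_mul, ih]
      ring
    simp only [this]
    rw [integral_const_mul, integral_dirichlet_mul_dirichlet]
    ring

/-- The weighted Dirichlet path kernel is integrable. -/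
theorem integrable_weight_mul_pathProd_dirichlet {γ : ℝ} (hγ : 0 ≤ γ) (m : ℕ)
    (hm : (m + 1) * γ < 1) (j : Fin m) :
    Integrable fun x : Fin m → ℝ => |x j| ^ γ * ‖pathProd (dirichlet 1) m 0 x 0‖ := by
  refine ((integrable_pathProd hγ m hm 0 0).const_mul (3 ^ (m + 1))).mono'
    (Continuous.aestronglyMeasurable ?_) (.of_forall fun x => ?_)
  · exact ((by fun_prop : Continuous fun x : Fin m → ℝ => |x j|).rpow_const fun _ =>
      Or.inr hγ).mul ((continuous_pathProd (continuous_dirichlet 1) m).comp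
      (by fun_prop : Continuous fun x : Fin m → ℝ => ((0 : ℝ), x, (0 : ℝ)))).norm
  · rw [Real.norm_of_nonneg (by positivity), norm_pathProd]
    have h1 := weight_mul_pathProd_le hγ (fun t => norm_nonneg (dirichlet 1 t)) m 0 x 0 j
    rw [sub_zero] at h1
    have h2 : |x j| ^ γ ≤ (1 + |x j|) ^ γ :=
      Real.rpow_le_rpow (abs_nonneg _) (by linarith) hγ
    refine (mul_le_mul_of_nonneg_right h2
      (pathProd_nonneg (fun t => norm_nonneg _) _ _ _ _)).trans (h1.trans ?_)
    rw [← pathProd_const_mul]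
    exact pathProd_mono (fun t => by positivity) (weighted_norm_dirichlet_one_le γ) _ _ _ _

end Dirichlet

/-! ### The trace as a kernel integral of correlations, and its rescaling. -/

section TraceFormula

/-- The product `A k * A (k + 1) * ⋯ * A (k + m - 1)`. -/
def prodFrom {M : Type*} [Monoid M] (A : ℕ → M) : ℕ → ℕ → M
  | _, 0 => 1
  | k, m + 1 => A k * prodFrom A (k + 1) m

theorem prodFrom_two_mul {M : Type*} [Monoid M] (A : ℕ → M) (a b : M)
    (ha : ∀ j, A (2 * j) = a) (hb : ∀ j, A (2 * j + 1) = b) (n j : ℕ) :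
    prodFrom A (2 * j) (2 * n) = (a * b) ^ n := by
  induction n generalizing j with
  | zero => simp [prodFrom]
  | succ n ih =>
    have : prodFrom A (2 * j) (2 * (n + 1)) =
        A (2 * j) * (A (2 * j + 1) * prodFrom A (2 * (j + 1)) (2 * n)) := rfl
    rw [this, ih, ha, hb, pow_succ', mul_assoc]

theorem norm_pathProd_dirichlet_le {T : ℝ} (hT : 0 ≤ T) (m : ℕ) (l : ℝ) (x : Fin m → ℝ) (k : ℝ) :
    ‖pathProd (dirichlet T) m l x k‖ ≤ T ^ (m + 1) := by
  induction m generalizing l with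
  | zero => simpa [pathProd] using norm_dirichlet_le hT (k - l)
  | succ m ih =>
    rw [pathProd, norm_mul, pow_succ']
    exact mul_le_mul (norm_dirichlet_le hT _) (ih _ _) (norm_nonneg _) hT

theorem integrable_prod_mul_pathProd {T : ℝ} (hT : 0 ≤ T) {m : ℕ} {g : Fin m → ℝ → ℝ}
    (hg : ∀ j, Integrable (g j)) (l k : ℝ) :
    Integrable fun x : Fin m → ℝ =>
      (∏ j, (g j (x j) : ℂ)) * pathProd (dirichlet T) m l x k := by
  refine (Integrable.fintype_prod (f := fun j t => (g j t : ℂ)) fun j => (hg j).ofReal).mul_bdd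
    (c := T ^ (m + 1)) ?_ (.of_forall fun x => norm_pathProd_dirichlet_le hT m l x k)
  exact ((continuous_pathProd (continuous_dirichlet T) m).comp
    (by fun_prop : Continuous fun x : Fin m → ℝ => (l, x, k))).aestronglyMeasurable

/-- Each operator contributes one frequency through its rank one representation, and each adjacent
pair of frequencies contributes a Dirichlet kernel. -/
theorem inner_prodFrom_W {T : ℝ} (hT : 0 ≤ T) {g : ℕ → ℝ → ℝ} (hg : ∀ j, Integrable (g j))
    (m k : ℕ) (l l' : ℝ) :
    (inner ℂ (expL2 T l) (prodFrom (fun j => W T (g j)) k m (expL2 T l')) : ℂ) =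
      ∫ x : Fin m → ℝ, (∏ j : Fin m, (g (k + j) (x j) : ℂ)) * pathProd (dirichlet T) m l x l' := by
  induction m generalizing k l with
  | zero =>
    simp [prodFrom, pathProd, inner_expL2_expL2, volume_pi, measureReal_def]
  | succ m ih =>
    have h1 : prodFrom (fun j => W T (g j)) k (m + 1) (expL2 T l') =
        W T (g k) (prodFrom (fun j => W T (g j)) (k + 1) m (expL2 T l')) := rfl
    rw [h1, (rankOneRep_W T (hg k)).rep, integral_cons
      (integrable_prod_mul_pathProd hT (g := fun j : Fin (m + 1) => g (k + j)) (fun j => hg _) l l')]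
    refine integral_congr_ae (.of_forall fun c => ?_)
    simp only [inner_expL2_expL2, pathProd_cons, Fin.prod_univ_succ, Fin.cons_zero, Fin.cons_succ,
      Fin.val_zero, add_zero, Fin.val_succ]
    rw [ih, ← mul_assoc, ← integral_const_mul]
    refine integral_congr_ae (.of_forall fun x => ?_)
    have : ∀ j : Fin m, k + 1 + (j : ℕ) = k + (j + 1) := fun j => by ring
    simp only [this]
    ring

/-- The correlation integral `∫ g₀(l) g₁(l + u₀) ⋯ gₘ(l + uₘ₋₁) dl`. -/
def corr (g : ℕ → ℝ → ℝ) (m : ℕ) (u : Fin m → ℝ) : ℝ :=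
  ∫ l, ∏ j : Fin (m + 1), g j (l + (Fin.cons 0 u : Fin (m + 1) → ℝ) j)

theorem measurePreserving_shear (m : ℕ) :
    MeasurePreserving (fun p : ℝ × (Fin m → ℝ) => (p.1, fun j => p.2 j + p.1)) := by
  refine (MeasurePreserving.id (volume : Measure ℝ)).skew_product
    (g := fun l (u : Fin m → ℝ) j => u j + l) ?_ (.of_forall fun l => ?_)
  · unfold Function.uncurry
    fun_prop
  · exact map_add_right_eq_self (volume : Measure (Fin m → ℝ)) (fun _ => l)

/-- The shear x_j = u_j + l preserves Lebesgue measure and turns the densities into a product of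
integrable functions of separate variables; the Dirichlet factor is bounded by T^(m+1). This
justifies Fubini for the trace integral. -/
theorem integrable_corr_kernel {T : ℝ} (hT : 0 ≤ T) {g : ℕ → ℝ → ℝ}
    (hg : ∀ j, Integrable (g j)) (m : ℕ) :
    Integrable (fun p : ℝ × (Fin m → ℝ) =>
      (∏ j : Fin (m + 1), (g j (p.1 + (Fin.cons 0 p.2 : Fin (m + 1) → ℝ) j) : ℂ)) *
        pathProd (dirichlet T) m 0 p.2 0) := by
  have h1 : Integrable (fun p : ℝ × (Fin m → ℝ) =>
      (g 0 p.1 : ℂ) * ∏ j : Fin m, (g (j + 1) (p.2 j) : ℂ)) :=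
    (hg 0).ofReal.mul_prod
      (Integrable.fintype_prod (f := fun (j : Fin m) t => (g (j + 1) t : ℂ)) fun j => (hg _).ofReal)
  have h2 := (measurePreserving_shear m).integrable_comp_of_integrable h1
  have h3 := h2.mul_bdd (c := T ^ (m + 1))
    (g := fun p : ℝ × (Fin m → ℝ) => pathProd (dirichlet T) m 0 p.2 0)
    ((continuous_pathProd (continuous_dirichlet T) m).comp
      (by fun_prop : Continuous fun p : ℝ × (Fin m → ℝ) =>
        ((0 : ℝ), p.2, (0 : ℝ)))).aestronglyMeasurable
    (.of_forall fun p => norm_pathProd_dirichlet_le hT m 0 p.2 0)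
  refine h3.congr (.of_forall fun p => ?_)
  simp [Fin.prod_univ_succ, add_comm]

/-- The trace integral in terms of the correlation integral. -/
theorem integral_inner_prodFrom_W {T : ℝ} (hT : 0 < T) {g : ℕ → ℝ → ℝ}
    (hg : ∀ j, Integrable (g j)) (m : ℕ) :
    ∫ l, (g 0 l : ℂ) * inner ℂ (expL2 T l) (prodFrom (fun j => W T (g j)) 1 m (expL2 T l)) =
      ∫ u : Fin m → ℝ, pathProd (dirichlet T) m 0 u 0 * (corr g m u : ℂ) := by
  have hint := integrable_corr_kernel hT.le hg m
  have h1 : ∀ u : Fin m → ℝ, pathProd (dirichlet T) m 0 u 0 * (corr g m u : ℂ) =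
      ∫ l, (∏ j : Fin (m + 1), (g j (l + (Fin.cons 0 u : Fin (m + 1) → ℝ) j) : ℂ)) *
        pathProd (dirichlet T) m 0 u 0 := fun u => by
    rw [integral_mul_const, mul_comm, corr, ← integral_complex_ofReal]
    simp only [Complex.ofReal_prod]
  simp only [h1]
  rw [← integral_integral_swap (f := fun l u =>
    (∏ j : Fin (m + 1), (g j (l + (Fin.cons 0 u : Fin (m + 1) → ℝ) j) : ℂ)) *
        pathProd (dirichlet T) m 0 u 0) hint]
  refine integral_congr_ae (.of_forall fun l => ?_)
  simp only
  rw [inner_prodFrom_W hT.le hg, ← integral_const_mul,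
    ← integral_add_right_eq_self _ (fun _ : Fin m => l)]
  refine integral_congr_ae (.of_forall fun u => ?_)
  have h2 := pathProd_add (dirichlet T) m 0 u 0 l
  rw [zero_add] at h2
  simp only [Fin.prod_univ_succ, Fin.cons_zero, Fin.cons_succ, Fin.val_zero, add_zero,
    Fin.val_succ]
  rw [← h2, ← mul_assoc]
  congr 2
  refine Finset.prod_congr rfl fun j _ => ?_
  rw [add_comm 1 (j : ℕ), add_comm l, Pi.add_apply]

theorem pathProd_dirichlet_eq {T : ℝ} (hT : 0 < T) (m : ℕ) (u : Fin m → ℝ) :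
    pathProd (dirichlet T) m 0 u 0 = (T : ℂ) ^ (m + 1) * pathProd (dirichlet 1) m 0 (T • u) 0 := by
  have h := pathProd_smul (dirichlet 1) (T : ℂ) T m 0 u 0
  rw [mul_zero] at h
  rw [← h]
  congr 1
  funext x
  exact dirichlet_eq_mul hT x

/-- The error of the trace approximation is controlled by the modulus of continuity of the
correlation integral at the origin. -/
theorem norm_trace_integral_sub_le {γ : ℝ} (hγ : 0 ≤ γ) {g : ℕ → ℝ → ℝ}
    (hg : ∀ j, Integrable (g j)) (m : ℕ) (hm : (m + 1) * γ < 1) {K : ℝ}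
    (hK : ∀ u, |corr g m u - corr g m 0| ≤ K * ∑ j, |u j| ^ γ) : ∃ C : ℝ, ∀ T : ℝ, 0 < T →
      ‖(1 / (T : ℂ)) * (∫ l, (g 0 l : ℂ) *
          inner ℂ (expL2 T l) (prodFrom (fun j => W T (g j)) 1 m (expL2 T l))) -
        (((2 * Real.pi) ^ m * corr g m 0 : ℝ) : ℂ)‖ ≤ C * T ^ (-γ) := by
  -- The constant is `K` times the sum of the absolute γ-moments of the kernel.
  refine ⟨∫ v : Fin m → ℝ, K * ∑ j, |v j| ^ γ * ‖pathProd (dirichlet 1) m 0 v 0‖,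
    fun T hT => ?_⟩
  have hTc : (T : ℂ) ≠ 0 := Complex.ofReal_ne_zero.2 hT.ne'
  have hint : Integrable fun u : Fin m → ℝ =>
      pathProd (dirichlet T) m 0 u 0 * (corr g m u : ℂ) := by
    refine (integrable_corr_kernel hT.le hg m).integral_prod_right.congr (.of_forall fun u => ?_)
    simp only
    rw [integral_mul_const, mul_comm, corr, ← integral_complex_ofReal]
    simp only [Complex.ofReal_prod]
  have e1 : ∀ u : Fin m → ℝ, pathProd (dirichlet T) m 0 u 0 * (corr g m u : ℂ) =
      (T : ℂ) ^ (m + 1) * ((fun v : Fin m → ℝ => pathProd (dirichlet 1) m 0 v 0 *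
        (corr g m (T⁻¹ • v) : ℂ)) (T • u)) := fun u => by
    simp only
    rw [pathProd_dirichlet_eq hT, inv_smul_smul₀ hT.ne', mul_assoc]
  have hint1 : Integrable fun v : Fin m → ℝ =>
      pathProd (dirichlet 1) m 0 v 0 * (corr g m (T⁻¹ • v) : ℂ) := by
    simp only [e1] at hint
    have h := hint.const_mul (((T : ℂ) ^ (m + 1))⁻¹)
    simp only [← mul_assoc, inv_mul_cancel₀ (pow_ne_zero _ hTc), one_mul] at h
    exact (integrable_comp_smul_iff volume (fun v : Fin m → ℝ =>
      pathProd (dirichlet 1) m 0 v 0 * (corr g m (T⁻¹ • v) : ℂ)) hT.ne').1 (by simpa using h)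
  -- Substitution v = Tu: the m + 1 kernels give T^(m+1), the Jacobian T^(-m), and the prefactor 1/T
  -- cancels the rest.
  have e2 : (1 / (T : ℂ)) * ∫ l, (g 0 l : ℂ) *
        inner ℂ (expL2 T l) (prodFrom (fun j => W T (g j)) 1 m (expL2 T l)) =
      ∫ v : Fin m → ℝ, pathProd (dirichlet 1) m 0 v 0 * (corr g m (T⁻¹ • v) : ℂ) := by
    rw [integral_inner_prodFrom_W hT hg]
    have h := Measure.integral_comp_smul_of_nonneg volume (fun v : Fin m → ℝ =>
      pathProd (dirichlet 1) m 0 v 0 * (corr g m (T⁻¹ • v) : ℂ)) T (hR := hT.le)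
    rw [integral_congr_ae (.of_forall e1), integral_const_mul, h]
    simp only [Module.finrank_fin_fun, Complex.real_smul]
    push_cast
    field_simp
    ring
  -- The path closes up, so the mass of the kernel is (2π)^m D_1(0), with D_1(0) = 1.
  have e3 : (((2 * Real.pi) ^ m * corr g m 0 : ℝ) : ℂ) =
      ∫ v : Fin m → ℝ, pathProd (dirichlet 1) m 0 v 0 * (corr g m 0 : ℂ) := by
    have : dirichlet 1 (0 - 0) = 1 := by simp [dirichlet]
    rw [integral_mul_const, integral_pathProd_dirichlet, this]
    push_cast
    ring
  rw [e2, e3, ← integral_sub hint1 ((integrable_pathProd_dirichlet m 0 0).mul_const _),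
    ← integral_mul_const]
  refine norm_integral_le_of_norm_le (((integrable_finsetSum _ fun j _ =>
    integrable_weight_mul_pathProd_dirichlet hγ m hm j).const_mul K).mul_const _)
    (.of_forall fun v => ?_)
  rw [← mul_sub, norm_mul, ← Complex.ofReal_sub, Complex.norm_real, Real.norm_eq_abs]
  have h4 := hK (T⁻¹ • v)
  have h5 : ∑ j, |(T⁻¹ • v) j| ^ γ = (∑ j, |v j| ^ γ) * T ^ (-γ) := by
    rw [Finset.sum_mul]
    refine Finset.sum_congr rfl fun j _ => ?_
    rw [Pi.smul_apply, smul_eq_mul, abs_mul, Real.mul_rpow (abs_nonneg _) (abs_nonneg _),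
      abs_of_pos (inv_pos.2 hT), Real.inv_rpow hT.le, Real.rpow_neg hT.le]
    ring
  rw [h5] at h4
  refine (mul_le_mul_of_nonneg_left h4 (norm_nonneg _)).trans (le_of_eq ?_)
  rw [← Finset.sum_mul]
  ring

end TraceFormula

/-! ### Hölder continuity of the correlation integral. -/

section Hoelder

/-- Telescoping. In each term the unchanged factors, some from `a` and some from `b`, are all
replaced by the maximum, so that the terms have one uniform shape for Hölder's inequality. -/
theorem abs_prod_sub_prod_le {ι : Type*} [DecidableEq ι] (s : Finset ι) {a b : ι → ℝ}
    (ha : ∀ i, 0 ≤ a i) (hb : ∀ i, 0 ≤ b i) :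
    |∏ i ∈ s, a i - ∏ i ∈ s, b i| ≤
      ∑ k ∈ s, ∏ i ∈ s, if i = k then |a i - b i| else max (a i) (b i) := by
  induction s using Finset.induction with
  | empty => simp
  | insert i s hi ih =>
    rw [Finset.prod_insert hi, Finset.prod_insert hi, Finset.sum_insert hi,
      Finset.prod_insert hi, if_pos rfl]
    have h1 : ∏ j ∈ s, (if j = i then |a j - b j| else max (a j) (b j)) =
        ∏ j ∈ s, max (a j) (b j) :=
      Finset.prod_congr rfl fun j hj => if_neg fun (h : j = i) => hi (h ▸ hj)
    have h2 : ∀ k ∈ s, ∏ j ∈ insert i s, (if j = k then |a j - b j| else max (a j) (b j)) =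
        max (a i) (b i) * ∏ j ∈ s, (if j = k then |a j - b j| else max (a j) (b j)) :=
      fun k hk => by rw [Finset.prod_insert hi, if_neg fun (h : i = k) => hi (h ▸ hk)]
    rw [h1, Finset.sum_congr rfl h2, ← Finset.mul_sum]
    have h3 : a i * ∏ j ∈ s, a j - b i * ∏ j ∈ s, b j =
        (a i - b i) * ∏ j ∈ s, a j + b i * (∏ j ∈ s, a j - ∏ j ∈ s, b j) := by ring
    rw [h3]
    refine (abs_add_le _ _).trans (add_le_add ?_ ?_)
    · rw [abs_mul, abs_of_nonneg (Finset.prod_nonneg fun j _ => ha j)]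
      exact mul_le_mul_of_nonneg_left (Finset.prod_le_prod (fun j _ => ha j)
        fun j _ => le_max_left _ _) (abs_nonneg _)
    · rw [abs_mul, abs_of_nonneg (hb i)]
      exact mul_le_mul (le_max_right _ _) ih (abs_nonneg _) ((hb i).trans (le_max_right _ _))

/-- Hölder's inequality for finitely many nonnegative functions, with `N i` bounding the
`L^{1/θ i}` norm of `h i`. -/
theorem integrable_prod_and_integral_le {ι : Type*} [Fintype ι] {h : ι → ℝ → ℝ} {θ N : ι → ℝ}
    (h0 : ∀ i l, 0 ≤ h i l) (hm : ∀ i, Measurable (h i)) (hθ : ∀ i, 0 < θ i)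
    (hsum : ∑ i, θ i = 1) (hN : ∀ i, 0 ≤ N i)
    (hle : ∀ i, ∫⁻ l, ENNReal.ofReal (h i l ^ (1 / θ i)) ≤ ENNReal.ofReal (N i ^ (1 / θ i))) :
    Integrable (fun l => ∏ i, h i l) ∧ ∫ l, ∏ i, h i l ≤ ∏ i, N i := by
  have e : ∀ {x : ℝ} (i : ι), 0 ≤ x → ENNReal.ofReal (x ^ (1 / θ i)) ^ θ i = ENNReal.ofReal x := by
    intro x i hx
    rw [ENNReal.ofReal_rpow_of_nonneg (by positivity) (hθ i).le, ← Real.rpow_mul hx,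
      one_div, inv_mul_cancel₀ (hθ i).ne', Real.rpow_one]
  have key : ∫⁻ l, ENNReal.ofReal (∏ i, h i l) ≤ ENNReal.ofReal (∏ i, N i) := by
    calc ∫⁻ l, ENNReal.ofReal (∏ i, h i l)
        = ∫⁻ l, ∏ i, ENNReal.ofReal (h i l ^ (1 / θ i)) ^ θ i := by
          refine lintegral_congr fun l => ?_
          rw [ENNReal.ofReal_prod_of_nonneg fun i _ => h0 i l]
          exact Finset.prod_congr rfl fun i _ => (e i (h0 i l)).symm
      _ ≤ ∏ i, (∫⁻ l, ENNReal.ofReal (h i l ^ (1 / θ i))) ^ θ i :=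
          ENNReal.lintegral_prod_norm_pow_le _
            (fun i _ => ((hm i).pow_const _).ennreal_ofReal.aemeasurable) hsum
            fun i _ => (hθ i).le
      _ ≤ ∏ i, ENNReal.ofReal (N i ^ (1 / θ i)) ^ θ i :=
          Finset.prod_le_prod' fun i _ => ENNReal.rpow_le_rpow (hle i) (hθ i).le
      _ = ENNReal.ofReal (∏ i, N i) := by
          rw [ENNReal.ofReal_prod_of_nonneg fun i _ => hN i]
          exact Finset.prod_congr rfl fun i _ => e i (hN i)
  have hmeas : Measurable fun l => ∏ i, h i l :=
    Finset.measurable_fun_prod _ fun i _ => hm i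
  have hnn : 0 ≤ᵐ[volume] fun l => ∏ i, h i l :=
    .of_forall fun l => Finset.prod_nonneg fun i _ => h0 i l
  refine ⟨⟨hmeas.aestronglyMeasurable, ?_⟩, ?_⟩
  · rw [hasFiniteIntegral_iff_ofReal hnn]
    exact key.trans_lt ENNReal.ofReal_lt_top
  · rw [integral_eq_lintegral_of_nonneg_ae hnn hmeas.aestronglyMeasurable]
    exact ENNReal.toReal_le_of_le_ofReal (Finset.prod_nonneg fun i _ => hN i) key

/-- Hölder continuity at the origin of the correlation integral. -/
theorem abs_corr_sub_le {γ B : ℝ} (hγ : 0 < γ) (hB : 0 ≤ B) {g : ℕ → ℝ → ℝ} {θ : ℕ → ℝ} (m : ℕ)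
    (h0 : ∀ j l, 0 ≤ g j l) (hm : ∀ j, Measurable (g j)) (hθ : ∀ j, 0 < θ j)
    (hsum : ∑ j : Fin (m + 1), θ j = 1)
    (hp : ∀ j, 2 * ∫⁻ l, ENNReal.ofReal (g j l ^ (1 / θ j)) ≤ ENNReal.ofReal (B ^ (1 / θ j)))
    (hmod : ∀ j v, ∫⁻ l, ENNReal.ofReal (|g j (l + v) - g j l| ^ (1 / θ j)) ≤
      ENNReal.ofReal ((B * |v| ^ γ) ^ (1 / θ j))) (u : Fin m → ℝ) :
    |corr g m u - corr g m 0| ≤ B ^ (m + 1) * ∑ j, |u j| ^ γ := by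
  set v : Fin (m + 1) → ℝ := Fin.cons 0 u with hv
  have htrans : ∀ (j : ℕ) (c : ℝ), ∫⁻ l, ENNReal.ofReal (g j (l + c) ^ (1 / θ j)) =
      ∫⁻ l, ENNReal.ofReal (g j l ^ (1 / θ j)) := fun j c =>
    lintegral_add_right_eq_self (fun l => ENNReal.ofReal (g j l ^ (1 / θ j))) c
  have hp' : ∀ j, ∫⁻ l, ENNReal.ofReal (g j l ^ (1 / θ j)) ≤ ENNReal.ofReal (B ^ (1 / θ j)) :=
    fun j => le_trans (le_mul_of_one_le_left zero_le (by norm_num)) (hp j)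
  have hmv : ∀ (j : ℕ) (c : ℝ), Measurable fun l => g j (l + c) := fun j c =>
    (hm j).comp (by fun_prop)
  have hI : ∀ w : Fin (m + 1) → ℝ, Integrable fun l => ∏ j : Fin (m + 1), g j (l + w j) :=
    fun w => (integrable_prod_and_integral_le (h := fun (j : Fin (m + 1)) l => g j (l + w j))
      (θ := fun j => θ j) (N := fun _ => B) (fun j l => h0 _ _) (fun j => hmv _ _)
      (fun j => hθ j) hsum (fun _ => hB) fun j => by
        rw [htrans]; exact hp' j).1
  have hz : corr g m 0 = ∫ l, ∏ j : Fin (m + 1), g j l := by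
    unfold corr
    simp [Fin.prod_univ_succ]
  have hI0 : Integrable fun l => ∏ j : Fin (m + 1), g j l := by
    simpa using hI 0
  have hk : ∀ k : Fin (m + 1), Integrable (fun l => ∏ j : Fin (m + 1),
        if j = k then |g j (l + v j) - g j l| else max (g j (l + v j)) (g j l)) ∧
      ∫ l, (∏ j : Fin (m + 1), if j = k then |g j (l + v j) - g j l|
        else max (g j (l + v j)) (g j l)) ≤ B ^ (m + 1) * |v k| ^ γ := by
    intro k
    have h := integrable_prod_and_integral_le
      (h := fun (j : Fin (m + 1)) l => if j = k then |g j (l + v j) - g j l|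
        else max (g j (l + v j)) (g j l))
      (θ := fun j => θ j) (N := fun j => B * if j = k then |v k| ^ γ else 1) ?_ ?_
      (fun j => hθ j) hsum ?_ ?_
    · refine ⟨h.1, h.2.trans (le_of_eq ?_)⟩
      rw [Finset.prod_mul_distrib, Finset.prod_ite_eq' Finset.univ k]
      simp
    · intro j l
      split_ifs
      · exact abs_nonneg _
      · exact (h0 _ _).trans (le_max_right _ _)
    · intro j
      split_ifs
      · exact ((hmv _ _).sub (hm _)).abs
      · exact (hmv _ _).max (hm _)
    · intro j
      split_ifs <;> positivity
    · intro j
      by_cases hjk : j = k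
      · subst hjk
        simp only [if_true]
        exact hmod j (v j)
      · simp only [if_neg hjk, mul_one]
        -- The p-th power of the maximum is at most the sum of both p-th powers, whose integrals
        -- agree by translation; hence the factor 2 in `hp`.
        refine le_trans ?_ (hp j)
        rw [two_mul]
        nth_rewrite 1 [← htrans j (v j)]
        rw [← lintegral_add_left (((hmv _ _).pow_const _).ennreal_ofReal)]
        refine lintegral_mono fun l => ?_
        rcases le_total (g j (l + v j)) (g j l) with hle | hle
        · simp only [max_eq_right hle]
          exact le_add_self
        · simp only [max_eq_left hle]
          exact le_self_add
  rw [hz, corr, ← integral_sub (hI _) hI0, ← Real.norm_eq_abs]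
  calc _ ≤ ∫ l, ∑ k : Fin (m + 1), ∏ j : Fin (m + 1),
        (if j = k then |g j (l + v j) - g j l| else max (g j (l + v j)) (g j l)) := by
        refine norm_integral_le_of_norm_le (integrable_finsetSum _ fun k _ => (hk k).1)
          (.of_forall fun l => ?_)
        exact abs_prod_sub_prod_le (a := fun j : Fin (m + 1) => g j (l + v j))
          (b := fun j : Fin (m + 1) => g j l) Finset.univ (fun j => h0 _ _) (fun j => h0 _ _)
    _ = ∑ k : Fin (m + 1), ∫ l, ∏ j : Fin (m + 1),
        (if j = k then |g j (l + v j) - g j l| else max (g j (l + v j)) (g j l)) :=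
        integral_finsetSum _ fun k _ => (hk k).1
    _ ≤ ∑ k : Fin (m + 1), B ^ (m + 1) * |v k| ^ γ := Finset.sum_le_sum fun k _ => (hk k).2
    _ = _ := by
        -- The term of index 0 vanishes: the first factor is not shifted and `γ > 0`.
        rw [← Finset.mul_sum, Fin.sum_univ_succ]
        simp [hv, Real.zero_rpow hγ.ne']

end Hoelder

/-! ### Riesz-Bessel densities: integrability and moduli of continuity. -/

section RieszBessel

theorem rieszBessel_nonneg {C : ℝ} (hC : 0 ≤ C) (α β l : ℝ) : 0 ≤ rieszBessel C α β l := by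
  unfold rieszBessel; positivity

theorem measurable_rieszBessel (C α β : ℝ) : Measurable (rieszBessel C α β) := by
  unfold rieszBessel
  have h1 : Measurable fun l : ℝ => |l| ^ (2 * α) := (measurable_norm (α := ℝ)).pow_const _
  have h2 : Measurable fun l : ℝ => (1 + l ^ 2) ^ β :=
    (by fun_prop : Measurable fun l : ℝ => 1 + l ^ 2).pow_const _
  exact measurable_const.div (h1.mul h2)

theorem rieszBessel_neg (C α β l : ℝ) : rieszBessel C α β (-l) = rieszBessel C α β l := by
  simp [rieszBessel]

theorem rieszBessel_le {C α β : ℝ} (hC : 0 ≤ C) (hβ : 0 ≤ β) (l : ℝ) :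
    rieszBessel C α β l ≤ C * |l| ^ (-(2 * α)) := by
  rw [Real.rpow_neg (abs_nonneg _), ← div_eq_mul_inv, rieszBessel, ← div_div]
  exact div_le_self (by positivity) (Real.one_le_rpow (by nlinarith) hβ)

theorem rieszBessel_le_rpow_add {C α β : ℝ} (hC : 0 ≤ C) (hβ : 0 ≤ β) {l : ℝ} (hl : 0 < l) :
    rieszBessel C α β l ≤ C * l ^ (-(2 * (α + β))) := by
  have h1 : l ^ (2 * β) ≤ (1 + l ^ 2) ^ β := by
    rw [Real.rpow_mul hl.le]
    refine Real.rpow_le_rpow (by positivity) ?_ hβ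
    norm_num
  rw [Real.rpow_neg hl.le, ← div_eq_mul_inv, rieszBessel, abs_of_pos hl, mul_add,
    Real.rpow_add hl]
  gcongr

/-- Closure of the family under powers is what reduces L^p questions to L¹ ones. -/
theorem rieszBessel_rpow {C : ℝ} (hC : 0 ≤ C) (α β p l : ℝ) :
    rieszBessel C α β l ^ p = rieszBessel (C ^ p) (α * p) (β * p) l := by
  unfold rieszBessel
  have : 0 ≤ 1 + l ^ 2 := by positivity
  rw [Real.div_rpow hC (by positivity), Real.mul_rpow (by positivity) (by positivity),
    ← Real.rpow_mul (abs_nonneg _), ← Real.rpow_mul this, mul_assoc]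

theorem rieszBessel_mul (C₁ C₂ α₁ α₂ β₁ β₂ : ℝ) {l : ℝ} (hl : l ≠ 0) :
    rieszBessel C₁ α₁ β₁ l * rieszBessel C₂ α₂ β₂ l =
      rieszBessel (C₁ * C₂) (α₁ + α₂) (β₁ + β₂) l := by
  unfold rieszBessel
  rw [mul_add, Real.rpow_add (abs_pos.2 hl), Real.rpow_add (by positivity), div_mul_div_comm]
  ring

theorem rieszBessel_anti {C α β : ℝ} (hC : 0 ≤ C) (hα : 0 ≤ α) (hβ : 0 ≤ β) {x y : ℝ}
    (hx : x ≠ 0) (hxy : |x| ≤ |y|) : rieszBessel C α β y ≤ rieszBessel C α β x := by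
  unfold rieszBessel
  have h0 : 0 < |x| := abs_pos.2 hx
  have h1 : x ^ 2 ≤ y ^ 2 := sq_le_sq.2 hxy
  gcongr

theorem integrable_rieszBessel {C α β : ℝ} (hC : 0 ≤ C) (hα : α < 1 / 2) (hβ : 0 ≤ β)
    (hαβ : 1 / 2 < α + β) : Integrable (rieszBessel C α β) := by
  have hmeas : ∀ s, AEStronglyMeasurable (rieszBessel C α β) (volume.restrict s) := fun s =>
    (measurable_rieszBessel C α β).aestronglyMeasurable
  have h1 : IntegrableOn (rieszBessel C α β) (Set.Ioc 0 1) := by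
    have h : IntegrableOn (fun x : ℝ => x ^ (-(2 * α))) (Set.Ioc 0 1) :=
      (intervalIntegrable_iff_integrableOn_Ioc_of_le zero_le_one).1
        (intervalIntegral.intervalIntegrable_rpow' (by linarith))
    refine (h.const_mul C).mono' (hmeas _) ?_
    filter_upwards [ae_restrict_mem measurableSet_Ioc] with x hx
    rw [Real.norm_of_nonneg (rieszBessel_nonneg hC _ _ _)]
    simpa [abs_of_pos hx.1] using rieszBessel_le (α := α) hC hβ x
  have h2 : IntegrableOn (rieszBessel C α β) (Set.Ioi 1) := by
    have h := integrableOn_Ioi_rpow_of_lt (a := -(2 * (α + β))) (by linarith) zero_lt_one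
    refine (h.const_mul C).mono' (hmeas _) ?_
    filter_upwards [ae_restrict_mem measurableSet_Ioi] with x hx
    rw [Real.norm_of_nonneg (rieszBessel_nonneg hC _ _ _)]
    exact rieszBessel_le_rpow_add hC hβ (zero_lt_one.trans hx)
  have h3 : IntegrableOn (rieszBessel C α β) (Set.Ioi 0) := by
    rw [← Set.Ioc_union_Ioi_eq_Ioi zero_le_one]
    exact h1.union h2
  have h4 : IntegrableOn (rieszBessel C α β) (Set.Iio 0) := by
    have h := IntegrableOn.comp_neg_Iio (f := rieszBessel C α β) (c := 0) (by simpa using h3)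
    simpa only [rieszBessel_neg] using h
  rw [← integrableOn_univ, ← Set.Iic_union_Ioi (a := (0 : ℝ))]
  exact ((integrableOn_Iic_iff_integrableOn_Iio).2 h4).union h3

/-- Translates of an even function decreasing in `|x|` in `L¹`. -/
theorem integral_abs_translate_sub_le {F : ℝ → ℝ} (hF : Integrable F)
    (hanti : ∀ x y, x ≠ 0 → |x| ≤ |y| → F y ≤ F x) {h : ℝ} (hh : 0 ≤ h) :
    ∫ x, |F (x + h) - F x| ≤ 2 * ∫ x in Set.Ico (-(h / 2)) (h / 2), F x := by
  have hFh := hF.comp_add_right h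
  have hD := (hFh.sub hF).abs
  simp only [Pi.sub_apply] at hD
  have hshift : ∀ s : Set ℝ, MeasurableSet s →
      ∫ x in (fun x => x + h) ⁻¹' s, F (x + h) = ∫ x in s, F x := fun s hs =>
    (measurePreserving_add_right volume h).setIntegral_preimage_emb
      (measurableEmbedding_addRight h) F s
  have hne : ∀ c : ℝ, ∀ᵐ x : ℝ, x ≠ c := fun c => by
    simp [ae_iff]
  have d1 : Disjoint (Set.Iio (-(h / 2))) (Set.Ico (-(h / 2)) (h / 2)) :=
    Set.disjoint_left.2 fun x hx hx' => not_le.2 hx hx'.1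
  have d2 : Disjoint (Set.Ico (-(h / 2)) (h / 2)) (Set.Ici (h / 2)) :=
    Set.disjoint_left.2 fun x hx hx' => not_le.2 hx.2 hx'
  -- The points x and x + h are equally far from 0 at x = -h/2, so F(x + h) - F(x) has a constant
  -- sign on either side, up to the exceptional point of `hanti`. On each side the integral
  -- telescopes to the mass of the central window.
  have hL : ∫ x in Set.Iio (-(h / 2)), |F (x + h) - F x| =
      ∫ x in Set.Ico (-(h / 2)) (h / 2), F x := by
    have e1 : ∫ x in Set.Iio (-(h / 2)), |F (x + h) - F x| =
        ∫ x in Set.Iio (-(h / 2)), (F (x + h) - F x) := by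
      refine setIntegral_congr_ae measurableSet_Iio ?_
      filter_upwards [hne (-h)] with x hx hxs
      rw [abs_of_nonneg (sub_nonneg.2 (hanti _ _ (fun h0 => hx (by linarith)) ?_))]
      have hxs' : x < -(h / 2) := hxs
      rw [abs_of_neg (by linarith : x < 0), abs_le]
      constructor <;> linarith
    have e2 := hshift (Set.Iio (h / 2)) measurableSet_Iio
    rw [Set.preimage_add_const_Iio, show h / 2 - h = -(h / 2) by ring] at e2
    rw [e1, integral_sub hFh.integrableOn hF.integrableOn, e2,
      ← Set.Iio_union_Ico_eq_Iio (show -(h / 2) ≤ h / 2 by linarith),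
      setIntegral_union d1 measurableSet_Ico hF.integrableOn
        hF.integrableOn]
    ring
  have hR : ∫ x in Set.Ici (-(h / 2)), |F (x + h) - F x| =
      ∫ x in Set.Ico (-(h / 2)) (h / 2), F x := by
    have e1 : ∫ x in Set.Ici (-(h / 2)), |F (x + h) - F x| =
        ∫ x in Set.Ici (-(h / 2)), (F x - F (x + h)) := by
      refine setIntegral_congr_ae measurableSet_Ici ?_
      filter_upwards [hne 0] with x hx hxs
      have hxs' : -(h / 2) ≤ x := hxs
      rw [abs_sub_comm, abs_of_nonneg (sub_nonneg.2 (hanti _ _ hx ?_))]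
      rw [abs_of_nonneg (by linarith : 0 ≤ x + h), abs_le]
      constructor <;> linarith
    have e2 := hshift (Set.Ici (h / 2)) measurableSet_Ici
    rw [Set.preimage_add_const_Ici, show h / 2 - h = -(h / 2) by ring] at e2
    rw [e1, integral_sub hF.integrableOn hFh.integrableOn, e2,
      ← Set.Ico_union_Ici_eq_Ici (show -(h / 2) ≤ h / 2 by linarith),
      setIntegral_union d2 measurableSet_Ici
        hF.integrableOn hF.integrableOn]
    ring
  rw [← integral_add_compl (measurableSet_Iio (a := -(h / 2))) hD, Set.compl_Iio, hL, hR]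
  linarith

theorem setIntegral_rieszBessel_le {C α β : ℝ} (hC : 0 ≤ C) (hα : α < 1 / 2) (hβ : 0 ≤ β)
    (hαβ : 1 / 2 < α + β) {r : ℝ} (hr : 0 ≤ r) :
    ∫ x in Set.Ico (-r) r, rieszBessel C α β x ≤ 2 * (C * (r ^ (1 - 2 * α) / (1 - 2 * α))) := by
  have hint := integrable_rieszBessel hC hα hβ hαβ
  have e1 : ∫ x in Set.Ico (-r) r, rieszBessel C α β x =
      2 * ∫ x in (0 : ℝ)..r, rieszBessel C α β x := by
    rw [integral_Ico_eq_integral_Ioo, ← integral_Ioc_eq_integral_Ioo,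
      ← intervalIntegral.integral_of_le (by linarith),
      ← intervalIntegral.integral_add_adjacent_intervals (b := 0) hint.intervalIntegrable
        hint.intervalIntegrable]
    have := intervalIntegral.integral_comp_neg (a := 0) (b := r) (rieszBessel C α β)
    simp only [rieszBessel_neg, neg_zero] at this
    rw [← this]
    ring
  have hi : IntervalIntegrable (fun x : ℝ => x ^ (-(2 * α))) volume 0 r :=
    intervalIntegral.intervalIntegrable_rpow' (by linarith)
  have e2 : ∫ x in (0 : ℝ)..r, rieszBessel C α β x ≤ ∫ x in (0 : ℝ)..r, C * x ^ (-(2 * α)) := by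
    refine intervalIntegral.integral_mono_on hr hint.intervalIntegrable (hi.const_mul C)
      fun x hx => ?_
    have := rieszBessel_le (α := α) hC hβ x
    rwa [abs_of_nonneg hx.1] at this
  rw [intervalIntegral.integral_const_mul, integral_rpow (Or.inl (by linarith)),
    Real.zero_rpow (by linarith), sub_zero, show -(2 * α) + 1 = 1 - 2 * α by ring] at e2
  rw [e1]
  linarith

/-- Only the mass within |h|/2 of the singularity matters, and there the density is at most
C|x|^(-2α). Negative h reduces to positive h by translation. -/
theorem integral_abs_rieszBessel_translate_sub_le {C α β : ℝ} (hC : 0 ≤ C) (hα0 : 0 ≤ α)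
    (hα : α < 1 / 2) (hβ : 0 ≤ β) (hαβ : 1 / 2 < α + β) (h : ℝ) :
    ∫ x, |rieszBessel C α β (x + h) - rieszBessel C α β x| ≤
      4 * (C / (1 - 2 * α)) * |h| ^ (1 - 2 * α) := by
  have hint := integrable_rieszBessel hC hα hβ hαβ
  have key : ∀ h : ℝ, 0 ≤ h → ∫ x, |rieszBessel C α β (x + h) - rieszBessel C α β x| ≤
      4 * (C / (1 - 2 * α)) * |h| ^ (1 - 2 * α) := fun h hh => by
    have h1 := integral_abs_translate_sub_le hint
      (fun x y hx hxy => rieszBessel_anti hC hα0 hβ hx hxy) hh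
    have h2 := setIntegral_rieszBessel_le hC hα hβ hαβ (r := h / 2) (by linarith)
    have h3 : (h / 2) ^ (1 - 2 * α) ≤ h ^ (1 - 2 * α) :=
      Real.rpow_le_rpow (by linarith) (by linarith) (by linarith)
    have h4 : 0 ≤ C / (1 - 2 * α) := div_nonneg hC (by linarith)
    rw [abs_of_nonneg hh]
    have h5 := mul_le_mul_of_nonneg_left h3 h4
    have h6 : C * ((h / 2) ^ (1 - 2 * α) / (1 - 2 * α)) =
        C / (1 - 2 * α) * (h / 2) ^ (1 - 2 * α) := by ring
    rw [h6] at h2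
    linarith
  rcases le_total 0 h with hh | hh
  · exact key h hh
  · have h1 := key (-h) (by linarith)
    rw [abs_neg] at h1
    rw [← integral_add_right_eq_self _ h] at h1
    simpa [abs_sub_comm] using h1

/-- Superadditivity of x ↦ x^p on [0, ∞) for p ≥ 1, applied to the smaller number and the
difference. -/
theorem abs_sub_rpow_le {a b p : ℝ} (ha : 0 ≤ a) (hb : 0 ≤ b) (hp : 1 ≤ p) :
    |a - b| ^ p ≤ |a ^ p - b ^ p| := by
  have key : ∀ {a b : ℝ}, 0 ≤ a → 0 ≤ b → b ≤ a → |a - b| ^ p ≤ |a ^ p - b ^ p| := by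
    intro a b ha hb hab
    have h := Real.add_rpow_le_rpow_add (sub_nonneg.2 hab) hb hp
    rw [sub_add_cancel] at h
    rw [abs_of_nonneg (sub_nonneg.2 hab)]
    exact le_trans (by linarith) (le_abs_self _)
  rcases le_total b a with h | h
  · exact key ha hb h
  · rw [abs_sub_comm, abs_sub_comm (a ^ p)]
    exact key hb ha h

/-- The `L^{1/θ}` norm and the `L^{1/θ}` modulus of continuity of a Riesz-Bessel density. -/
theorem exists_rieszBessel_bound {C α β γ θ : ℝ} (hC : 0 ≤ C) (hα0 : 0 ≤ α) (hγ : 0 < γ)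
    (hβ : 0 ≤ β) (hαβ : 1 / 2 < α + β) (hθ : θ = 2 * α + γ) (hθ1 : θ ≤ 1) :
    ∃ B₀ : ℝ, ∀ B : ℝ, B₀ ≤ B →
      2 * ∫⁻ l, ENNReal.ofReal (rieszBessel C α β l ^ (1 / θ)) ≤ ENNReal.ofReal (B ^ (1 / θ)) ∧
      ∀ v, ∫⁻ l, ENNReal.ofReal (|rieszBessel C α β (l + v) - rieszBessel C α β l| ^ (1 / θ)) ≤
        ENNReal.ofReal ((B * |v| ^ γ) ^ (1 / θ)) := by
  have hθ0 : 0 < θ := by linarith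
  have hp : 1 ≤ 1 / θ := by rw [le_div_iff₀ hθ0]; linarith
  set p := 1 / θ with hpdef
  have hp0 : 0 < p := by linarith
  have hθp : θ * p = 1 := by rw [hpdef]; field_simp
  have hαp : α * p < 1 / 2 := by nlinarith
  have hβp : 0 ≤ β * p := by positivity
  have hαβp : 1 / 2 < α * p + β * p := by nlinarith
  have hCp : 0 ≤ C ^ p := by positivity
  -- The choice of `θ` makes the L¹ modulus of the p-th power have order γp, that is, order `γ`
  -- after taking p-th roots.
  have hexp : 1 - 2 * (α * p) = γ * p := by
    have : (2 * α + γ) * p = 1 := by rw [← hθ, hθp]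
    linarith
  have hint := integrable_rieszBessel hCp hαp hβp hαβp
  set I := ∫ l, rieszBessel (C ^ p) (α * p) (β * p) l with hI
  set M := 4 * (C ^ p / (1 - 2 * (α * p))) with hM
  have hI0 : 0 ≤ I := integral_nonneg fun l => rieszBessel_nonneg hCp _ _ _
  have hM0 : 0 ≤ M := by
    have : 0 < 1 - 2 * (α * p) := by linarith
    positivity
  have hroot : ∀ {x B : ℝ}, 0 ≤ x → x ^ θ ≤ B → x ≤ B ^ p := fun {x B} hx hB => by
    have h := Real.rpow_le_rpow (by positivity) hB hp0.le
    rwa [← Real.rpow_mul hx, hθp, Real.rpow_one] at h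
  -- Any larger `B` works too, so that one constant can later serve both densities.
  refine ⟨max ((2 * I) ^ θ) (M ^ θ), fun B hB => ⟨?_, fun v => ?_⟩⟩
  · have h1 : 2 * I ≤ B ^ p := hroot (by positivity) ((le_max_left _ _).trans hB)
    simp only [rieszBessel_rpow hC]
    rw [← ofReal_integral_eq_lintegral_ofReal hint
      (.of_forall fun l => rieszBessel_nonneg hCp _ _ _)]
    refine le_trans (le_of_eq ?_) (ENNReal.ofReal_le_ofReal h1)
    rw [ENNReal.ofReal_mul (by norm_num), ENNReal.ofReal_ofNat]
  · have h1 : M ≤ B ^ p := hroot hM0 ((le_max_right _ _).trans hB)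
    have hB0 : 0 ≤ B := le_trans (by positivity) ((le_max_right _ _).trans hB)
    have h2 := integral_abs_rieszBessel_translate_sub_le hCp (by positivity : 0 ≤ α * p) hαp hβp
      hαβp v
    calc _ ≤ ∫⁻ l, ENNReal.ofReal |rieszBessel (C ^ p) (α * p) (β * p) (l + v) -
            rieszBessel (C ^ p) (α * p) (β * p) l| := by
          refine lintegral_mono fun l => ENNReal.ofReal_le_ofReal ?_
          rw [← rieszBessel_rpow hC, ← rieszBessel_rpow hC]
          exact abs_sub_rpow_le (rieszBessel_nonneg hC _ _ _) (rieszBessel_nonneg hC _ _ _) hp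
      _ = ENNReal.ofReal (∫ l, |rieszBessel (C ^ p) (α * p) (β * p) (l + v) -
            rieszBessel (C ^ p) (α * p) (β * p) l|) :=
          (ofReal_integral_eq_lintegral_ofReal ((hint.comp_add_right v).sub hint).abs
            (.of_forall fun l => abs_nonneg _)).symm
      _ ≤ _ := by
          refine ENNReal.ofReal_le_ofReal (h2.trans ?_)
          rw [Real.mul_rpow hB0 (by positivity), ← Real.rpow_mul (abs_nonneg _), ← hexp]
          exact mul_le_mul_of_nonneg_right h1 (by positivity)

end RieszBessel

/-! ### Alternating products and the error rate. -/

section Main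

/-- The periodic sequence `a, b, a, b, …`. -/
def alt {X : Type*} (a b : X) (j : ℕ) : X := if Even j then a else b

theorem alt_two_mul {X : Type*} (a b : X) (j : ℕ) : alt a b (2 * j) = a := by
  simp [alt]

theorem alt_two_mul_add_one {X : Type*} (a b : X) (j : ℕ) : alt a b (2 * j + 1) = b := by
  simp [alt]

theorem alt_forall {X : Type*} {p : X → Prop} {a b : X} (ha : p a) (hb : p b) (j : ℕ) :
    p (alt a b j) := by
  unfold alt; split_ifs <;> assumption

theorem alt_forall₂ {X Y : Type*} {p : X → Y → Prop} {a b : X} {c d : Y} (ha : p a c)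
    (hb : p b d) (j : ℕ) : p (alt a b j) (alt c d j) := by
  unfold alt; split_ifs <;> assumption

theorem prod_range_alt (a b : ℝ → ℝ) (l : ℝ) (n : ℕ) :
    ∏ j ∈ Finset.range (2 * n), alt a b j l = (a l * b l) ^ n := by
  induction n with
  | zero => simp
  | succ n ih =>
    rw [show 2 * (n + 1) = 2 * n + 1 + 1 by ring, Finset.prod_range_succ, Finset.prod_range_succ,
      ih, alt_two_mul, alt_two_mul_add_one, pow_succ, mul_assoc]

theorem sum_range_alt (a b : ℝ) (n : ℕ) :
    ∑ j ∈ Finset.range (2 * n), alt a b j = n * (a + b) := by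
  induction n with
  | zero => simp
  | succ n ih =>
    rw [show 2 * (n + 1) = 2 * n + 1 + 1 by ring, Finset.sum_range_succ, Finset.sum_range_succ,
      ih, alt_two_mul, alt_two_mul_add_one]
    push_cast
    ring

theorem corr_alt_zero (f₁ f₂ : ℝ → ℝ) (n : ℕ) :
    corr (alt f₁ f₂) (2 * n + 1) 0 = ∫ l, (f₁ l * f₂ l) ^ (n + 1) := by
  unfold corr
  refine integral_congr_ae (.of_forall fun l => ?_)
  have h0 : (Fin.cons 0 0 : Fin (2 * n + 1 + 1) → ℝ) = 0 := by
    funext j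
    refine Fin.cases ?_ (fun i => ?_) j <;> simp
  simp only [h0, Pi.zero_apply, add_zero]
  rw [Fin.prod_univ_eq_prod_range (fun j => alt f₁ f₂ j l) (2 * n + 1 + 1)]
  exact prod_range_alt f₁ f₂ l (n + 1)

/-- The first factor is split off because its rank one representation supplies the outer integral of
the trace. -/
theorem pow_W_mul_W (T : ℝ) (f₁ f₂ : ℝ → ℝ) (n : ℕ) :
    (W T f₁ * W T f₂) ^ (n + 1) =
      W T f₁ * prodFrom (fun j => W T (alt f₁ f₂ j)) 1 (2 * n + 1) := by
  rw [← prodFrom_two_mul (fun j => W T (alt f₁ f₂ j)) (W T f₁) (W T f₂)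
    (fun j => by rw [alt_two_mul]) (fun j => by rw [alt_two_mul_add_one]) (n + 1) 0]
  rfl

theorem secondCountableTopology_L2 (T : ℝ) : SecondCountableTopology (L2 T) :=
  have : Fact ((2 : ENNReal) ≠ ⊤) := ⟨by norm_num⟩
  Lp.SecondCountableTopology

theorem isTraceClass_pow_W_mul_W (T : ℝ) {f₁ f₂ : ℝ → ℝ} (hf₁ : Integrable f₁)
    (hf₂ : Integrable f₂) (n : ℕ) : IsTraceClass ((W T f₁ * W T f₂) ^ (n + 1)) := by
  obtain ⟨w, b, -⟩ := exists_hilbertBasis ℂ (L2 T)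
  have := secondCountableTopology_L2 T
  have := countable_of_hilbertBasis b
  rw [pow_W_mul_W]
  exact (rankOneRep_W T hf₁).isTraceClass_mul b
    (RankOneRep.summable_adjoint_mul_norm_sq b (rankOneRep_W T hf₂) _)

theorem trace_pow_W_mul_W (T : ℝ) {f₁ f₂ : ℝ → ℝ} (hf₁ : Integrable f₁)
    (hf₂ : Integrable f₂) (n : ℕ) : trace ((W T f₁ * W T f₂) ^ (n + 1)) =
      ∫ l, (f₁ l : ℂ) * inner ℂ (expL2 T l)
        (prodFrom (fun j => W T (alt f₁ f₂ j)) 1 (2 * n + 1) (expL2 T l)) := by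
  obtain ⟨w, b, -⟩ := exists_hilbertBasis ℂ (L2 T)
  have := secondCountableTopology_L2 T
  have := countable_of_hilbertBasis b
  refine ((isTraceClass_pow_W_mul_W T hf₁ hf₂ n).hasSum_trace b).unique ?_
  rw [pow_W_mul_W]
  exact (rankOneRep_W T hf₁).hasSum_inner b _

/-- The error rate `T ^ (-γ)`, provided that the correlation integral of the densities is Hölder
continuous of order `γ` at the origin. -/
theorem exists_error_le {γ : ℝ} (hγ : 0 ≤ γ) {f₁ f₂ : ℝ → ℝ} (hf₁ : Integrable f₁)
    (hf₂ : Integrable f₂) (n : ℕ) (hn : 2 * (n + 1) * γ < 1) {K : ℝ}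
    (hK : ∀ u, |corr (alt f₁ f₂) (2 * n + 1) u - corr (alt f₁ f₂) (2 * n + 1) 0| ≤
      K * ∑ j, |u j| ^ γ) :
    ∃ C : ℝ, ∀ T : ℝ, 0 < T → Δ (n + 1) f₁ f₂ T ≤ C * T ^ (-γ) := by
  obtain ⟨C, hC⟩ := norm_trace_integral_sub_le hγ
    (alt_forall (p := fun f : ℝ → ℝ => Integrable f) hf₁ hf₂)
    (2 * n + 1) (by push_cast; linarith) hK
  refine ⟨C, fun T hT => ?_⟩
  rw [Δ, S, trace_pow_W_mul_W T hf₁ hf₂, ← corr_alt_zero]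
  exact hC T hT

end Main
end TruncToeplitz
end

open TruncToeplitz

theorem theorem4p4 (ν : ℕ) (hν : 1 ≤ ν) (C₁ C₂ α₁ α₂ β₁ β₂ : ℝ)
    (hC₁ : 0 < C₁) (hC₂ : 0 < C₂)
    (hα₁ : 0 < α₁) (hα₁' : α₁ < 1 / 2) (hα₂ : 0 < α₂) (hα₂' : α₂ < 1 / 2)
    (hβ₁ : 1 / 2 < α₁ + β₁) (hβ₂ : 1 / 2 < α₂ + β₂)
    (hα : α₁ + α₂ < 1 / (2 * (ν : ℝ))) :
    -- all the quantities involved are well defined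
    (Integrable (TruncToeplitz.rieszBessel C₁ α₁ β₁) ∧
      Integrable (TruncToeplitz.rieszBessel C₂ α₂ β₂) ∧
      Integrable (fun l => (TruncToeplitz.rieszBessel C₁ α₁ β₁ l *
        TruncToeplitz.rieszBessel C₂ α₂ β₂ l) ^ ν) ∧
      ∀ T : ℝ, 0 < T → TruncToeplitz.IsTraceClass
        ((TruncToeplitz.W T (TruncToeplitz.rieszBessel C₁ α₁ β₁) *
          TruncToeplitz.W T (TruncToeplitz.rieszBessel C₂ α₂ β₂)) ^ ν)) ∧
    -- the error rate
    ∀ ε : ℝ, 0 < ε →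
      TruncToeplitz.Δ ν (TruncToeplitz.rieszBessel C₁ α₁ β₁)
          (TruncToeplitz.rieszBessel C₂ α₂ β₂)
        =O[atTop] fun T : ℝ => T ^ (-(1 / (2 * (ν : ℝ)) - (α₁ + α₂)) + ε) := by
  -- With ν = n + 1 the number of free frequencies is 2ν - 1 = 2n + 1, without truncated
  -- subtraction.
  obtain ⟨n, rfl⟩ : ∃ n, ν = n + 1 := ⟨ν - 1, by omega⟩
  have hβ₁0 : 0 ≤ β₁ := by linarith
  have hβ₂0 : 0 ≤ β₂ := by linarith
  have hf₁ := integrable_rieszBessel hC₁.le hα₁' hβ₁0 hβ₁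
  have hf₂ := integrable_rieszBessel hC₂.le hα₂' hβ₂0 hβ₂
  have hν0 : (1 : ℝ) ≤ ((n + 1 : ℕ) : ℝ) := by exact_mod_cast hν
  have hνα : (α₁ + α₂) * ((n + 1 : ℕ) : ℝ) < 1 / 2 := by
    rw [lt_div_iff₀ (by positivity)] at hα
    linarith
  refine ⟨⟨hf₁, hf₂, ?_, fun T _ => isTraceClass_pow_W_mul_W T hf₁ hf₂ n⟩, fun ε hε => ?_⟩
  -- Away from 0, (f₁f₂)^ν is itself a Riesz-Bessel density, with singularity exponent ν(α₁ + α₂) <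
  -- 1/2.
  · have h := integrable_rieszBessel (C := (C₁ * C₂) ^ ((n + 1 : ℕ) : ℝ))
      (α := (α₁ + α₂) * ((n + 1 : ℕ) : ℝ)) (β := (β₁ + β₂) * ((n + 1 : ℕ) : ℝ)) (by positivity)
      hνα (by positivity) (by nlinarith)
    refine h.congr ?_
    have hne : ∀ᵐ l : ℝ, l ≠ 0 := by simp [ae_iff]
    filter_upwards [hne] with l hl
    rw [rieszBessel_mul _ _ _ _ _ _ hl, ← Real.rpow_natCast, rieszBessel_rpow (by positivity)]
  · set γ := 1 / (2 * ((n + 1 : ℕ) : ℝ)) - (α₁ + α₂) with hγ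
    have hγ0 : 0 < γ := by linarith
    -- The value of `γ` is exactly the one for which the 2ν Hölder weights 2α_i + γ sum to 1.
    have hνγ : ((n + 1 : ℕ) : ℝ) * ((2 * α₁ + γ) + (2 * α₂ + γ)) = 1 := by
      rw [hγ]; field_simp; ring
    have hθ₁0 : 0 < 2 * α₁ + γ := by linarith
    have hθ₂0 : 0 < 2 * α₂ + γ := by linarith
    have hθ : (2 * α₁ + γ) + (2 * α₂ + γ) ≤ 1 := by nlinarith
    obtain ⟨B₁, hB₁⟩ := exists_rieszBessel_bound (γ := γ) hC₁.le hα₁.le hγ0 hβ₁0 hβ₁ rfl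
      (by linarith)
    obtain ⟨B₂, hB₂⟩ := exists_rieszBessel_bound (γ := γ) hC₂.le hα₂.le hγ0 hβ₂0 hβ₂ rfl
      (by linarith)
    set B := max 0 (max B₁ B₂) with hB
    have h₁ := hB₁ B ((le_max_left _ _).trans (le_max_right _ _))
    have h₂ := hB₂ B ((le_max_right _ _).trans (le_max_right _ _))
    have hK := abs_corr_sub_le hγ0 (le_max_left 0 (max B₁ B₂))
      (g := alt (rieszBessel C₁ α₁ β₁) (rieszBessel C₂ α₂ β₂))
      (θ := alt (2 * α₁ + γ) (2 * α₂ + γ)) (2 * n + 1)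
      (alt_forall (p := fun f : ℝ → ℝ => ∀ l, 0 ≤ f l) (rieszBessel_nonneg hC₁.le _ _)
        (rieszBessel_nonneg hC₂.le _ _))
      (alt_forall (p := Measurable) (measurable_rieszBessel _ _ _) (measurable_rieszBessel _ _ _))
      (alt_forall (p := fun t => 0 < t) hθ₁0 hθ₂0)
      (by
        rw [Fin.sum_univ_eq_sum_range (fun j => alt (2 * α₁ + γ) (2 * α₂ + γ) j) (2 * n + 1 + 1)]
        rw [← hνγ]
        exact sum_range_alt _ _ (n + 1))
      (alt_forall₂ (p := fun (f : ℝ → ℝ) (t : ℝ) => 2 * ∫⁻ l, ENNReal.ofReal (f l ^ (1 / t)) ≤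
        ENNReal.ofReal (B ^ (1 / t))) h₁.1 h₂.1)
      (alt_forall₂ (p := fun (f : ℝ → ℝ) (t : ℝ) => ∀ v,
        ∫⁻ l, ENNReal.ofReal (|f (l + v) - f l| ^ (1 / t)) ≤
          ENNReal.ofReal ((B * |v| ^ γ) ^ (1 / t))) h₁.2 h₂.2)
    -- By `hνγ`, 2νγ = 1 - 2ν(α₁ + α₂), which is strictly below 1 because the α_i are positive.
    obtain ⟨C, hC⟩ := exists_error_le hγ0.le hf₁ hf₂ n (by push_cast at hνγ; nlinarith) hK
    refine Asymptotics.IsBigO.of_bound |C| ?_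
    filter_upwards [eventually_ge_atTop 1] with T hT
    have hT0 : 0 < T := by linarith
    rw [Real.norm_of_nonneg (show 0 ≤ Δ (n + 1) _ _ T from norm_nonneg _),
      Real.norm_of_nonneg (by positivity)]
    refine (hC T hT0).trans (mul_le_mul (le_abs_self C) ?_ (by positivity) (abs_nonneg C))
    -- The bound obtained has the exponent -γ itself; the `ε` only weakens it, for `T ≥ 1`.
    exact Real.rpow_le_rpow_of_exponent_le hT (by linarith)
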